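/- Let $\mathbb{T}^\infty$ be the product of countably many unit circles, with normalized Haar measure $dm_\infty=\frac{d\theta_1}{2\pi}\times\frac{d\theta_2}{2\pi}\times\cdots$, and let $\mathbb{D}_1^\infty=\{\zeta\in\ell^1: |\zeta_n|<1 \text{ for all } n\ge 1\}$, an open subset of the complex Banach space $\ell^1$. A function $F:\mathbb{D}_1^\infty\to\mathbb{C}$ is holomorphic if it is locally bounded and, for all $\zeta\in\mathbb{D}_1^\infty$ and $\xi\in\ell^1$, the function $z\mapsto F(\zeta+z\xi)$ is holomorphic on $\{z\in\mathbb{C}:\zeta+z\xi\in\mathbb{D}_1^\infty\}$. For $0<r<1$ and $w\in\mathbb{T}^\infty$ put $F_{[r]}(w)=F(rw_1,r^2w_2,\ldots,r^nw_n,\ldots)$. The Nevanlinna class $N(\mathbb{D}_1^\infty)$ consists of all holomorphic $F$ on $\mathbb{D}_1^\infty$ with $\sup_{0<r<1}\int_{\mathbb{T}^\infty}\log^+|F_{[r]}|\,dm_\infty<\infty$. The Smirnov class $N_*(\mathbb{D}_1^\infty)$ consists of all $F\in N(\mathbb{D}_1^\infty)$ for which the family $\{\log^+|F_{[r]}|\}_{0<r<1}$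 is uniformly integrable on $\mathbb{T}^\infty$. For a measurable function $f$ on $\mathbb{T}^\infty$ write $\|f\|_0=\int_{\mathbb{T}^\infty}\log(1+|f|)\,dm_\infty\in[0,\infty]$. Let $F\in N(\mathbb{D}_1^\infty)$. Then the radial limit $F^*(w)=\lim_{r\to1^-}F_{[r]}(w)$ exists for almost every $w\in\mathbb{T}^\infty$, and the following statements are equivalent: (1) $F\in N_*(\mathbb{D}_1^\infty)$. (2) $\|F^*\|_0=\lim_{r\to1^-}\|F_{[r]}\|_0$. (3) $\lim_{r\to1^-}\|F_{[r]}-F^*\|_0=0$. (4) $\lim_{r\to1^-}\int_{\mathbb{T}^\infty}\log^+|F_{[r]}|\,dm_\infty=\int_{\mathbb{T}^\infty}\log^+|F^*|\,dm_\infty$. -/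

import Mathlib

open Filter Topology MeasureTheory Set
open scoped ENNReal

namespace InfSmirnov

noncomputable section

/-- The complex Banach space `ℓ¹` of absolutely summable sequences. The coordinates are indexed
by `0, 1, 2, …`, so the coordinate with index `n` here is `ζ_{n+1}` in the usual numbering. -/
abbrev EllOne : Type := lp (fun _ : ℕ => ℂ) 1

/-- The domain `𝔻₁^∞ = ℓ¹ ∩ 𝔻^∞` in `ℓ¹`. -/
def polydisk : Set EllOne := {ζ | ∀ n, ‖ζ n‖ < 1}

/-- A complex function on a subset `V` (in practice an open set) of a complex normed space is
holomorphic if it is locally bounded and holomorphic along every complex line. -/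
def IsHolomorphicOn {X : Type*} [NormedAddCommGroup X] [NormedSpace ℂ X]
    (F : X → ℂ) (V : Set X) : Prop :=
  (∀ x₀ ∈ V, ∃ M : ℝ, ∀ᶠ x in 𝓝[V] x₀, ‖F x‖ ≤ M) ∧
    ∀ x₀ ∈ V, ∀ x : X, DifferentiableOn ℂ (fun z : ℂ => F (x₀ + z • x)) {z | x₀ + z • x ∈ V}

instance : MeasurableSpace Circle := borel Circle

instance : BorelSpace Circle := ⟨rfl⟩

/-- The normalized arc length `dθ / 2π` on the unit circle `𝕋`. -/
def circleMeasure : Measure Circle :=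
  ((ENNReal.ofReal (2 * Real.pi))⁻¹ • (volume.restrict (Ioc (0 : ℝ) (2 * Real.pi)))).map Circle.exp

instance : IsProbabilityMeasure circleMeasure := by
  constructor
  have h : (0 : ℝ) < 2 * Real.pi := by positivity
  have hm : Measurable (Circle.exp : ℝ → Circle) := Circle.exp.continuous.measurable
  rw [circleMeasure, Measure.map_apply hm MeasurableSet.univ]
  simp only [preimage_univ, Measure.smul_apply, Measure.restrict_apply_univ, Real.volume_Ioc,
    sub_zero, smul_eq_mul]
  exact ENNReal.inv_mul_cancel (by simpa using h) ENNReal.ofReal_ne_top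

/-- The infinite torus `𝕋^∞`. -/
abbrev Torus : Type := ℕ → Circle

/-- The normalized Haar measure `dm_∞ = dθ₁/2π × dθ₂/2π × ⋯` on `𝕋^∞`. -/
def torusMeasure : Measure Torus := Measure.infinitePi fun _ : ℕ => circleMeasure

open scoped Classical in
/-- The point `(r w₁, r² w₂, …, rⁿ wₙ, …)` of `ℓ¹`. It lies in `ℓ¹` for `0 < r < 1`, the only
values of `r` that matter; otherwise the value is irrelevant (and set to `0` if not in `ℓ¹`). -/
def dilate (r : ℝ) (w : Torus) : EllOne :=
  if h : Memℓp (fun n : ℕ => (r : ℂ) ^ (n + 1) * (w n : ℂ)) 1 then ⟨_, h⟩ else 0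

theorem dilate_apply {r : ℝ} (hr : r ∈ Ioo (0 : ℝ) 1) (w : Torus) (n : ℕ) :
    dilate r w n = (r : ℂ) ^ (n + 1) * (w n : ℂ) := by
  have h : Memℓp (fun n : ℕ => (r : ℂ) ^ (n + 1) * (w n : ℂ)) 1 := by
    refine memℓp_gen ?_
    have hs : Summable fun n : ℕ => r ^ (n + 1) :=
      (summable_nat_add_iff 1).2 (summable_geometric_of_lt_one hr.1.le hr.2)
    simpa [abs_of_pos hr.1, Circle.norm_coe] using hs
  rw [dilate, dif_pos h]

theorem dilate_mem_polydisk {r : ℝ} (hr : r ∈ Ioo (0 : ℝ) 1) (w : Torus) :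
    dilate r w ∈ polydisk := by
  intro n
  rw [dilate_apply hr]
  simpa [abs_of_pos hr.1, Circle.norm_coe] using pow_lt_one₀ hr.1.le hr.2 (Nat.succ_ne_zero n)

/-- The function `F_[r](w) = F(r w₁, …, rⁿ wₙ, …)` on `𝕋^∞`, for `0 < r < 1`. -/
def radial (F : EllOne → ℂ) (r : ℝ) (w : Torus) : ℂ := F (dilate r w)

/-- The boundary function `F^*(w) = lim_{r → 1⁻} F_[r](w)`, with an arbitrary value at the
points `w` where the limit does not exist. -/
def boundary (F : EllOne → ℂ) (w : Torus) : ℂ := limUnder (𝓝[<] (1 : ℝ)) fun r => radial F r w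

/-- The integral `∫ log⁺ |f| dm_∞`, with values in `[0, ∞]`. -/
def posLogIntegral (f : Torus → ℂ) : ℝ≥0∞ :=
  ∫⁻ w, ENNReal.ofReal (Real.posLog ‖f w‖) ∂torusMeasure

/-- The functional `‖f‖₀ = ∫ log (1 + |f|) dm_∞`, with values in `[0, ∞]`. -/
def normZero (f : Torus → ℂ) : ℝ≥0∞ :=
  ∫⁻ w, ENNReal.ofReal (Real.log (1 + ‖f w‖)) ∂torusMeasure

/-- The Nevanlinna class `N(𝔻₁^∞)`. Only the values of `F` on `𝔻₁^∞` matter. -/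
def nevanlinnaClass : Set (EllOne → ℂ) :=
  {F | IsHolomorphicOn F polydisk ∧ ⨆ r ∈ Ioo (0 : ℝ) 1, posLogIntegral (radial F r) < ∞}

/-- The Smirnov class `N_*(𝔻₁^∞)`: the functions `F` in the Nevanlinna class for which
`{log⁺ |F_[r]|}`, `0 < r < 1`, is uniformly integrable. -/
def smirnovClass : Set (EllOne → ℂ) :=
  {F | F ∈ nevanlinnaClass ∧
    UniformIntegrable (fun (r : Ioo (0 : ℝ) 1) (w : Torus) => Real.posLog ‖radial F r w‖) 1
      torusMeasure}

end

end InfSmirnov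

namespace InfSmirnov

/-! Radial limits come from one-variable theory on slices. For fixed `w` the map `z ↦ F (torusCurve
w z)` is holomorphic on the disc. Its value at `r e^{iθ}` is `F_[r]` at the rotated point `rotate
(e^{iθ}) w`. Rotations preserve `torusMeasure`, so Tonelli and Fatou's lemma show that for almost
every `w` the circle means of `log⁺` of the slice stay bounded along infinitely many radii tending
to 1. Fatou's theorem on the disc (`ae_tendsto_circleMap_of_nevanlinna`) gives limits at `rotate
(e^{iθ}) w` for almost all `θ`. Fubini yields one `θ` good for almost all `w`, and invariance
removes that rotation.

On the disc, a bounded function has a Lipschitz primitive. The primitive is differentiable along the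
circle almost everywhere, and a Poisson estimate turns this into a radial limit of the function
itself. A function with bounded `log⁺` means is a quotient of bounded functions
(`exists_bounded_quotient`), and by Jensen's inequality the denominator almost never tends to 0.

The equivalence (`tfae_uniformIntegrable_posLog`) is measure theory: (1) → (4) is Vitali, (4) → (3)
is dominated convergence with varying majorants, (3) → (2) is the triangle inequality for `log (1 +
|·|)`, and (2) → (1) is Scheffé. Scheffé controls only `r` near 1; for the other radii, compactness
bounds `F_[r]` uniformly. -/

/-! ### Radial limits of bounded holomorphic functions on the disc -/

theorem norm_circleAverage_le {E : Type*} [NormedAddCommGroup E] [NormedSpace ℝ E] (f : ℂ → E)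
    (c : ℂ) (R : ℝ) :
    ‖Real.circleAverage f c R‖ ≤ Real.circleAverage (fun z => ‖f z‖) c R := by
  rw [Real.circleAverage_def, Real.circleAverage_def, norm_smul, smul_eq_mul, Real.norm_of_nonneg
    (by positivity)]
  gcongr
  exact intervalIntegral.norm_integral_le_integral_norm (by positivity)

/-- The difference of the squares is `(s - 1) (s + 1 - 2 Re (ζ ζ̄₀))`, and the real part is at most
1. This lets a pole at `ζ₀` be moved outside the closed disc without losing bounds. -/
theorem norm_sub_le_norm_sub_real_mul {ζ ζ₀ : ℂ} (h₀ : ‖ζ₀‖ = 1) (h : ‖ζ‖ ≤ 1) {s : ℝ}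
    (hs : 1 ≤ s) : ‖ζ - ζ₀‖ ≤ ‖ζ - s * ζ₀‖ := by
  have h1 : ζ₀.re ^ 2 + ζ₀.im ^ 2 = 1 := by
    have := Complex.sq_norm ζ₀
    rw [h₀, Complex.normSq_apply] at this
    nlinarith
  have h2 : ζ.re ^ 2 + ζ.im ^ 2 ≤ 1 := by
    have := Complex.sq_norm ζ
    rw [Complex.normSq_apply] at this
    nlinarith [norm_nonneg ζ]
  refine abs_le_of_sq_le_sq' ?_ (norm_nonneg _) |>.2
  rw [Complex.sq_norm, Complex.sq_norm, Complex.normSq_apply, Complex.normSq_apply]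
  simp only [Complex.sub_re, Complex.sub_im, Complex.mul_re, Complex.ofReal_re, Complex.ofReal_im,
    Complex.mul_im, zero_mul, sub_zero, add_zero]
  have h3 : ζ.re * ζ₀.re + ζ.im * ζ₀.im ≤ 1 := by
    nlinarith [sq_nonneg (ζ.re - ζ₀.re), sq_nonneg (ζ.im - ζ₀.im)]
  nlinarith [mul_nonneg (sub_nonneg.2 hs) (sub_nonneg.2 h3), sq_nonneg (s - 1)]

/-- A holomorphic function on the disc whose boundary values are small compared with the distance
to `ζ₀` near `ζ₀` is itself small compared with the distance to `ζ₀` near `ζ₀`. -/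
theorem norm_le_of_boundary_isLittleO {H : ℂ → ℂ} {ζ₀ z : ℂ} {M ε δ : ℝ}
    (hH : DiffContOnCl ℂ H (Metric.ball 0 1)) (h₀ : ‖ζ₀‖ = 1) (hε : 0 ≤ ε) (hδ : 0 < δ)
    (hM : ∀ ζ : ℂ, ‖ζ‖ = 1 → ‖H ζ‖ ≤ M * ‖ζ - ζ₀‖)
    (hs : ∀ ζ : ℂ, ‖ζ‖ = 1 → ‖ζ - ζ₀‖ < δ → ‖H ζ‖ ≤ ε * ‖ζ - ζ₀‖)
    (hM0 : 0 ≤ M) (hz : ‖z‖ < 1) (hzδ : ‖z - ζ₀‖ < δ / 2) :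
    ‖H z‖ ≤ ‖z - ζ₀‖ * (ε + M * ((1 - ‖z‖ ^ 2) / (δ / 2) ^ 2)) := by
  set B : ℝ := ε + M * ((1 - ‖z‖ ^ 2) / (δ / 2) ^ 2) with hB
  have hzb : z ∈ Metric.ball (0 : ℂ) 1 := by simpa using hz
  have hz2 : 0 ≤ 1 - ‖z‖ ^ 2 := by nlinarith [norm_nonneg z]
  -- Dividing `H` by `ζ - ζ₀` would put a singularity on the circle. The Poisson formula is applied
  -- to `H / (ζ - s ζ₀)` with `s > 1` instead, and `s → 1` at the end.
  have key : ∀ s : ℝ, 1 < s → ‖H z‖ ≤ ‖z - s * ζ₀‖ * B := by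
    intro s hs1
    have hne : ∀ ζ : ℂ, ‖ζ‖ ≤ 1 → ζ - s * ζ₀ ≠ 0 := by
      intro ζ hζ h
      rw [sub_eq_zero] at h
      rw [h, norm_mul, h₀, mul_one, Complex.norm_real, Real.norm_of_nonneg (by linarith)] at hζ
      linarith
    have hcl : closure (Metric.ball (0 : ℂ) 1) = Metric.closedBall 0 1 :=
      closure_ball _ one_ne_zero
    have hK : DiffContOnCl ℂ (fun ζ => (ζ - s * ζ₀)⁻¹ • H ζ) (Metric.ball 0 1) := by
      refine DiffContOnCl.smul (DiffContOnCl.inv ?_ ?_) hH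
      · exact (Differentiable.diffContOnCl (by fun_prop))
      · intro x hx
        rw [hcl] at hx
        exact hne x (by simpa using hx)
    have hP := hK.circleAverage_poissonKernel_smul hzb
    have h1 : DiffContOnCl ℂ (fun _ : ℂ => (1 : ℂ)) (Metric.ball 0 1) := diffContOnCl_const
    have hP1 := h1.circleAverage_poissonKernel_smul hzb
    have hsph : Metric.sphere (0 : ℂ) |1| = Metric.sphere 0 1 := by simp
    have hcP : ContinuousOn (poissonKernel 0 z) (Metric.sphere 0 1) := by
      rw [poissonKernel_eq_re_herglotzRieszKernel]
      exact Complex.continuous_re.comp_continuousOn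
        (by simpa using continuousOn_herglotzRieszKernel_sphere hzb)
    have hP1' : Real.circleAverage (poissonKernel 0 z) 0 1 = 1 := by
      have h2 := Complex.reCLM.circleAverage_comp_comm (f := poissonKernel 0 z • fun _ : ℂ => (1 : ℂ))
        (c := 0) (R := 1) ((hcP.smul continuousOn_const).circleIntegrable zero_le_one)
      rw [hP1] at h2
      simpa [Function.comp_def] using h2
    have hPpos : ∀ ζ : ℂ, ‖ζ‖ = 1 → 0 ≤ poissonKernel 0 z ζ := by
      intro ζ hζ
      rw [poissonKernel_def]
      simp only [sub_zero, hζ]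
      exact div_nonneg (by nlinarith) (by positivity)
    have hbound : ∀ ζ ∈ Metric.sphere (0 : ℂ) 1,
        ‖(poissonKernel 0 z • fun ζ => (ζ - s * ζ₀)⁻¹ • H ζ) ζ‖ ≤
          ε * poissonKernel 0 z ζ + M * ((1 - ‖z‖ ^ 2) / (δ / 2) ^ 2) := by
      intro ζ hζ
      have hζ1 : ‖ζ‖ = 1 := by simpa using hζ
      have hp := hPpos ζ hζ1
      have hd := norm_sub_le_norm_sub_real_mul h₀ hζ1.le hs1.le
      have hpos : 0 < ‖ζ - s * ζ₀‖ := norm_pos_iff.2 (hne ζ hζ1.le)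
      simp only [Pi.smul_apply', norm_smul, norm_inv, Real.norm_of_nonneg hp]
      rw [mul_comm ε]
      -- Near `ζ₀` the quotient is at most `ε`. Away from it the quotient is at most `M`, and the
      -- kernel is small because `‖ζ - z‖ ≥ δ / 2`.
      by_cases hcase : ‖ζ - ζ₀‖ < δ
      · have h3 : ‖ζ - s * ζ₀‖⁻¹ * ‖H ζ‖ ≤ ε := by
          rw [inv_mul_le_iff₀ hpos, mul_comm]
          exact (hs ζ hζ1 hcase).trans (by gcongr)
        have h4 : 0 ≤ M * ((1 - ‖z‖ ^ 2) / (δ / 2) ^ 2) := by positivity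
        nlinarith [mul_le_mul_of_nonneg_left h3 hp]
      · have h3 : ‖ζ - s * ζ₀‖⁻¹ * ‖H ζ‖ ≤ M := by
          rw [inv_mul_le_iff₀ hpos, mul_comm]
          exact (hM ζ hζ1).trans (by gcongr)
        have h4 : δ / 2 ≤ ‖ζ - z‖ := by
          have := norm_sub_le_norm_sub_add_norm_sub ζ z ζ₀
          linarith [not_lt.1 hcase]
        have h5 : poissonKernel 0 z ζ ≤ (1 - ‖z‖ ^ 2) / (δ / 2) ^ 2 := by
          rw [poissonKernel_def]
          simp only [sub_zero, hζ1, one_pow]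
          gcongr
        calc poissonKernel 0 z ζ * (‖ζ - s * ζ₀‖⁻¹ * ‖H ζ‖)
            ≤ poissonKernel 0 z ζ * M := by gcongr
          _ ≤ (1 - ‖z‖ ^ 2) / (δ / 2) ^ 2 * M := by gcongr
          _ ≤ _ := by nlinarith [mul_nonneg hp hε]
    have hKc : ContinuousOn (fun ζ => (ζ - s * ζ₀)⁻¹ • H ζ) (Metric.sphere 0 1) :=
      hK.2.mono (by rw [hcl]; exact Metric.sphere_subset_closedBall)
    have hle : ‖(z - s * ζ₀)⁻¹ • H z‖ ≤ B := by
      rw [← hP]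
      refine (norm_circleAverage_le _ _ _).trans ((Real.circleAverage_mono
        (f₂ := fun ζ => ε * poissonKernel 0 z ζ + M * ((1 - ‖z‖ ^ 2) / (δ / 2) ^ 2)) ?_ ?_ ?_).trans
        ?_)
      · exact ((hcP.smul hKc).norm).circleIntegrable zero_le_one
      · exact ((hcP.const_smul ε).add continuousOn_const).circleIntegrable zero_le_one
      · rw [hsph]
        exact hbound
      · rw [Real.circleAverage_fun_add (f₁ := fun ζ => ε * poissonKernel 0 z ζ)
          ((hcP.const_smul ε).circleIntegrable zero_le_one)
          (continuousOn_const.circleIntegrable zero_le_one), Real.circleAverage_const]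
        have := Real.circleAverage_fun_smul (a := ε) (f := poissonKernel 0 z) (c := 0) (R := 1)
        simp only [smul_eq_mul] at this
        rw [this, hP1', mul_one]
    rw [norm_smul, norm_inv, inv_mul_le_iff₀ (norm_pos_iff.2 (hne z hz.le))] at hle
    exact hle
  have ht : Tendsto (fun s : ℝ => ‖z - s * ζ₀‖ * B) (𝓝[>] 1) (𝓝 (‖z - (1 : ℝ) * ζ₀‖ * B)) := by
    refine Tendsto.mono_left (Continuous.tendsto ?_ _) nhdsWithin_le_nhds
    fun_prop
  have := ge_of_tendsto ht (eventually_nhdsWithin_of_forall key)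
  simpa using this

/-- If a Lipschitz function, holomorphic on the disc, is differentiable along the circle at a point,
then its complex derivative has a radial limit there. -/
theorem tendsto_deriv_of_hasDerivAt_circleMap {G : ℂ → ℂ} {K : NNReal} (hG : LipschitzWith K G)
    (hd : DifferentiableOn ℂ G (Metric.ball 0 1)) {θ : ℝ} {d : ℂ}
    (hθ : HasDerivAt (fun t : ℝ => G (circleMap 0 1 t)) d θ) :
    ∃ c, Tendsto (fun r : ℝ => deriv G (circleMap 0 r θ)) (𝓝[<] 1) (𝓝 c) := by
  set ζ₀ : ℂ := circleMap 0 1 θ with hζ₀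
  have h₀ : ‖ζ₀‖ = 1 := by simp [hζ₀]
  have hne : ζ₀ ≠ 0 := by
    intro h; simp [h] at h₀
  -- The chain rule value: the derivative of `circleMap 0 1` at `θ` is `ζ₀ * I`.
  set c : ℂ := d / (ζ₀ * Complex.I) with hc
  refine ⟨c, ?_⟩
  set H : ℂ → ℂ := fun z => G z - G ζ₀ - c * (z - ζ₀) with hHdef
  have hHL : ∀ z, ‖H z‖ ≤ (K + ‖c‖) * ‖z - ζ₀‖ := by
    intro z
    have h1 := hG.dist_le_mul z ζ₀
    rw [dist_eq_norm, dist_eq_norm] at h1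
    calc ‖H z‖ ≤ ‖G z - G ζ₀‖ + ‖c * (z - ζ₀)‖ := norm_sub_le _ _
      _ ≤ K * ‖z - ζ₀‖ + ‖c‖ * ‖z - ζ₀‖ := by rw [norm_mul]; gcongr
      _ = _ := by ring
  have hHd : DifferentiableOn ℂ H (Metric.ball 0 1) := by
    exact (hd.sub_const _).sub (by fun_prop)
  have hHc : Continuous H := by
    have := hG.continuous
    fun_prop
  have hHdc : DiffContOnCl ℂ H (Metric.ball 0 1) := ⟨hHd, hHc.continuousOn⟩
  -- Near `ζ₀` on the circle, `ζ ↦ θ + arg (ζ / ζ₀)` inverts the parametrization and is Lipschitz at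
  -- `ζ₀`, so the little-o in the angle becomes one in `ζ - ζ₀`.
  have hlo : H =o[𝓝[Metric.sphere 0 1] ζ₀] (fun ζ => ζ - ζ₀) := by
    have h1 : HasDerivAt (fun t : ℝ => H (circleMap 0 1 t)) 0 θ := by
      have h2 := (hθ.sub_const (G ζ₀)).sub
        (((hasDerivAt_circleMap 0 1 θ).sub_const ζ₀).const_mul c)
      have h3 : d - c * (circleMap 0 1 θ * Complex.I) = 0 := by
        rw [hc, ← hζ₀]
        field_simp
        simp
      rw [h3] at h2
      exact h2
    rw [hasDerivAt_iff_isLittleO] at h1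
    have hH0 : H (circleMap 0 1 θ) = 0 := by simp [hHdef, hζ₀]
    simp only [hH0, smul_zero, sub_zero] at h1
    have hlog : HasDerivAt (fun ζ : ℂ => Complex.log (ζ / ζ₀)) (1 / ζ₀ / (ζ₀ / ζ₀)) ζ₀ := by
      refine HasDerivAt.clog ((hasDerivAt_id ζ₀).div_const ζ₀) ?_
      simp [div_self hne]
    have harg : Tendsto (fun ζ : ℂ => θ + (ζ / ζ₀).arg) (𝓝[Metric.sphere 0 1] ζ₀) (𝓝 θ) := by
      have h5 : ContinuousAt (fun ζ : ℂ => θ + (ζ / ζ₀).arg) ζ₀ := by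
        refine continuousAt_const.add (ContinuousAt.comp (g := Complex.arg) ?_ (by fun_prop))
        refine Complex.continuousAt_arg ?_
        simp [div_self hne]
      have h6 : Tendsto (fun ζ : ℂ => θ + (ζ / ζ₀).arg) (𝓝 ζ₀) (𝓝 (θ + (ζ₀ / ζ₀).arg)) := h5
      simp only [div_self hne, Complex.arg_one, add_zero] at h6
      exact h6.mono_left nhdsWithin_le_nhds
    have h7 := h1.comp_tendsto harg
    have h8 : (fun ζ : ℂ => θ + (ζ / ζ₀).arg - θ) =O[𝓝[Metric.sphere 0 1] ζ₀]
        (fun ζ => ζ - ζ₀) := by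
      have h9 := hlog.isBigO_sub
      simp only [div_self hne, Complex.log_one, sub_zero] at h9
      refine Asymptotics.IsBigO.trans (Asymptotics.isBigO_of_le _ fun ζ => ?_)
        (h9.mono nhdsWithin_le_nhds)
      rw [add_sub_cancel_left, ← Complex.log_im]
      exact Complex.abs_im_le_norm _
    refine (h7.trans_isBigO h8).congr' ?_ EventuallyEq.rfl
    filter_upwards [self_mem_nhdsWithin] with ζ hζ
    simp only [Function.comp_apply]
    congr 1
    have hn : ‖ζ / ζ₀‖ = 1 := by
      rw [norm_div, h₀]
      simpa using hζ
    have h10 := Complex.norm_mul_exp_arg_mul_I (ζ / ζ₀)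
    rw [hn, Complex.ofReal_one, one_mul] at h10
    rw [circleMap, zero_add, Complex.ofReal_one, one_mul, Complex.ofReal_add, add_mul,
      Complex.exp_add, h10]
    have : Complex.exp (θ * Complex.I) = ζ₀ := by simp [hζ₀, circleMap]
    rw [this, mul_div_cancel₀ _ hne]
  rw [Metric.tendsto_nhds]
  intro ε hε
  have hε4 : 0 < ε / 8 := by positivity
  obtain ⟨δ, hδ, hδH⟩ : ∃ δ > 0, ∀ ζ : ℂ, ‖ζ‖ = 1 → ‖ζ - ζ₀‖ < δ → ‖H ζ‖ ≤ ε / 8 * ‖ζ - ζ₀‖ := by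
    have h1 := hlo.def hε4
    rw [eventually_nhdsWithin_iff, Metric.eventually_nhds_iff] at h1
    obtain ⟨δ, hδ, h⟩ := h1
    exact ⟨δ, hδ, fun ζ h2 h3 => h (by rwa [dist_eq_norm]) (by simpa using h2)⟩
  have hMnn : 0 ≤ (K : ℝ) + ‖c‖ := by positivity
  set M : ℝ := K + ‖c‖ with hM
  have hlim : ∀ᶠ r : ℝ in 𝓝[<] 1, M * (2 * (2 * (1 - r)) / (δ / 2) ^ 2) < ε / 8 := by
    have : Tendsto (fun r : ℝ => M * (2 * (2 * (1 - r)) / (δ / 2) ^ 2)) (𝓝[<] 1)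
        (𝓝 (M * (2 * (2 * (1 - 1)) / (δ / 2) ^ 2))) :=
      Tendsto.mono_left (Continuous.tendsto (by fun_prop) _) nhdsWithin_le_nhds
    refine this.eventually_lt_const ?_
    simpa using hε4
  have hr0 : ∀ᶠ r : ℝ in 𝓝[<] 1, max 0 (1 - δ / 4) < r :=
    Filter.Eventually.filter_mono nhdsWithin_le_nhds (lt_mem_nhds (by simp [hδ]))
  filter_upwards [hlim, hr0, self_mem_nhdsWithin] with r hr1 hr2 hr3
  have hr3' : r < 1 := hr3
  have hrpos : 0 < r := (le_max_left _ _).trans_lt hr2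
  have hrδ : 1 - δ / 4 < r := (le_max_right _ _).trans_lt hr2
  set z : ℂ := circleMap 0 r θ with hz
  have hznorm : ‖z‖ = r := by simp [hz, abs_of_pos hrpos]
  have hzζ : ‖z - ζ₀‖ = 1 - r := by
    have : z - ζ₀ = ((r - 1 : ℝ) : ℂ) * ζ₀ := by
      simp only [hz, hζ₀, circleMap]; push_cast; ring
    rw [this, norm_mul, h₀, mul_one, Complex.norm_real, Real.norm_of_nonpos (by linarith)]
    ring
  have hderiv : deriv H z = deriv G z - c := by
    have hGz : HasDerivAt G (deriv G z) z :=
      (hd.differentiableAt (Metric.isOpen_ball.mem_nhds (by simp [hznorm, hr3']))).hasDerivAt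
    have h1 : HasDerivAt H (deriv G z - c * 1) z :=
      (hGz.sub_const (G ζ₀)).sub (((hasDerivAt_id z).sub_const ζ₀).const_mul c)
    rw [h1.deriv, mul_one]
  have hη : 0 < (1 - r) / 2 := by linarith
  have hsub : Metric.closedBall z ((1 - r) / 2) ⊆ Metric.ball 0 1 := by
    intro w hw
    have h1 : ‖w - z‖ ≤ (1 - r) / 2 := by simpa [dist_eq_norm] using hw
    have h2 := norm_le_norm_add_norm_sub' w z
    simp only [Metric.mem_ball, dist_zero_right]
    linarith
  -- Cauchy's estimate on the circle of radius `(1 - r) / 2` about `z`. The factors `1 - r` cancel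
  -- and leave `3 ε / 4`.
  have hest : ‖deriv H z‖ ≤ (3 / 2 * (1 - r) * (ε / 8 + ε / 8)) / ((1 - r) / 2) := by
    refine Complex.norm_deriv_le_of_forall_mem_sphere_norm_le hη
      ⟨hHd.mono (Metric.ball_subset_closedBall.trans hsub), hHc.continuousOn⟩ fun w hw => ?_
    have hwb : ‖w‖ < 1 := by simpa using hsub (Metric.sphere_subset_closedBall hw)
    have h1 : ‖w - z‖ = (1 - r) / 2 := by simpa [dist_eq_norm] using hw
    have h2 : ‖w - ζ₀‖ ≤ 3 / 2 * (1 - r) := by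
      have := norm_sub_le_norm_sub_add_norm_sub w z ζ₀
      linarith
    have h3 := norm_le_of_boundary_isLittleO hHdc h₀ hε4.le hδ (fun ζ _ => hHL ζ) hδH hMnn hwb
      (by linarith)
    refine h3.trans ?_
    have h4 : 1 - ‖w‖ ^ 2 ≤ 2 * (2 * (1 - r)) := by
      have := norm_le_norm_add_norm_sub' z w
      rw [hznorm, norm_sub_rev, h1] at this
      nlinarith [norm_nonneg w]
    have h5 : M * ((1 - ‖w‖ ^ 2) / (δ / 2) ^ 2) ≤ ε / 8 := by
      refine le_trans ?_ hr1.le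
      gcongr
    exact mul_le_mul h2 (by linarith) (add_nonneg hε4.le (mul_nonneg hMnn (div_nonneg
      (by nlinarith [norm_nonneg w]) (by positivity)))) (by linarith)
  rw [dist_eq_norm, ← hderiv]
  refine hest.trans_lt ?_
  rw [div_lt_iff₀ hη]
  nlinarith [mul_pos hε hη]

/-- **Fatou's theorem** for bounded holomorphic functions on the disc. -/
theorem ae_tendsto_circleMap_of_bounded {f : ℂ → ℂ} (hf : DifferentiableOn ℂ f (Metric.ball 0 1))
    {M : ℝ} (hM : ∀ z ∈ Metric.ball (0 : ℂ) 1, ‖f z‖ ≤ M) :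
    ∀ᵐ θ : ℝ, ∃ c, Tendsto (fun r : ℝ => f (circleMap 0 r θ)) (𝓝[<] 1) (𝓝 c) := by
  -- A primitive has derivative bounded by `M`, hence is Lipschitz and extends to the plane; its
  -- restriction to the circle is then differentiable almost everywhere.
  obtain ⟨g, hg⟩ := hf.isExactOn_ball
  have hM0 : 0 ≤ M := (norm_nonneg _).trans (hM 0 (by simp))
  have hgL : LipschitzOnWith M.toNNReal g (Metric.ball 0 1) := by
    refine (convex_ball (0 : ℂ) 1).lipschitzOnWith_of_nnnorm_deriv_le (𝕜 := ℂ)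
      (fun x hx => (hg x hx).differentiableAt) fun x hx => ?_
    rw [(hg x hx).deriv, ← NNReal.coe_le_coe, Real.coe_toNNReal _ hM0]
    exact hM x hx
  obtain ⟨G, hGL, hGg⟩ := hgL.extend_finite_dimension
  have hGd : ∀ z ∈ Metric.ball (0 : ℂ) 1, HasDerivAt G (f z) z := by
    intro z hz
    refine (hg z hz).congr_of_eventuallyEq ?_
    filter_upwards [Metric.isOpen_ball.mem_nhds hz] with w hw
    exact (hGg hw).symm
  have hL : LipschitzWith _ (fun t : ℝ => G (circleMap 0 1 t)) :=
    hGL.comp (lipschitzWith_circleMap 0 1)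
  filter_upwards [hL.ae_differentiableAt_real] with θ hθ
  obtain ⟨c, hc⟩ := tendsto_deriv_of_hasDerivAt_circleMap hGL
    (fun z hz => (hGd z hz).differentiableAt.differentiableWithinAt) hθ.hasDerivAt
  refine ⟨c, hc.congr' ?_⟩
  have : ∀ᶠ r : ℝ in 𝓝[<] 1, 0 < r :=
    Filter.Eventually.filter_mono nhdsWithin_le_nhds (lt_mem_nhds zero_lt_one)
  filter_upwards [self_mem_nhdsWithin, this] with r hr hr0
  refine (hGd _ ?_).deriv
  have hr' : r < 1 := hr
  simpa [abs_of_pos hr0] using hr'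

/-! ### Jensen's inequality and the set where a radial limit vanishes -/

/-- Jensen's inequality for the logarithm of the modulus of a holomorphic function. -/
theorem log_norm_le_circleAverage {h : ℂ → ℂ} {R : ℝ} (hR : 0 < R)
    (hh : AnalyticOnNhd ℂ h (Metric.closedBall 0 R)) (h0 : h 0 ≠ 0) :
    Real.log ‖h 0‖ ≤ Real.circleAverage (Real.log ‖h ·‖) 0 R := by
  rw [← abs_of_pos hR] at hh
  rw [AnalyticOnNhd.circleAverage_log_norm hR.ne' hh h0]
  refine le_add_of_nonneg_left (finsum_nonneg fun u => ?_)
  by_cases hu : u ∈ Metric.closedBall (0 : ℂ) |R|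
  · refine mul_nonneg ?_ ?_
    · exact_mod_cast (MeromorphicOn.AnalyticOnNhd.divisor_nonneg hh) u
    · rcases eq_or_ne u 0 with rfl | hne
      · simp
      · refine Real.log_nonneg ?_
        have : ‖u‖ ≤ R := by simpa [abs_of_pos hR] using hu
        rw [zero_sub, norm_neg, ← div_eq_mul_inv, one_le_div (norm_pos_iff.2 hne)]
        exact this
  · simp [Function.locallyFinsuppWithin.apply_eq_zero_of_notMem _ hu]

/-- A bounded holomorphic function on the disc that does not vanish at the origin has almost nowhere
the radial limit `0`. -/
theorem ae_not_tendsto_zero_of_bounded {h : ℂ → ℂ}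
    (hh : DifferentiableOn ℂ h (Metric.ball 0 1)) (hb : ∀ z ∈ Metric.ball (0 : ℂ) 1, ‖h z‖ ≤ 1)
    (h0 : h 0 ≠ 0) :
    ∀ᵐ θ ∂(volume.restrict (Ioc (0 : ℝ) (2 * Real.pi))),
      ¬ Tendsto (fun r : ℝ => h (circleMap 0 r θ)) (𝓝[<] 1) (𝓝 0) := by
  obtain ⟨r, -, hrm, hrt⟩ := exists_seq_strictMono_tendsto' (zero_lt_one (α := ℝ))
  have han : AnalyticOnNhd ℂ h (Metric.ball 0 1) := hh.analyticOnNhd Metric.isOpen_ball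
  have hmem : ∀ n θ, circleMap 0 (r n) θ ∈ Metric.ball (0 : ℂ) 1 := by
    intro n θ
    simpa [abs_of_pos (hrm n).1] using (hrm n).2
  -- This is the truncation `min (-log |h|) (log (n + 1))` on the circle of radius `r n`, continuous
  -- and nonnegative. Jensen's inequality for `(n + 1) h` bounds its integral independently of `n`,
  -- whereas a radial limit 0 would force `ψ n θ → ∞`.
  set ψ : ℕ → ℝ → ℝ := fun n θ =>
    Real.log (n + 1) - Real.posLog ‖(n + 1 : ℂ) * h (circleMap 0 (r n) θ)‖ with hψ
  have hn1 : ∀ n : ℕ, ‖(n + 1 : ℂ)‖ = n + 1 := by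
    intro n
    exact_mod_cast Complex.norm_natCast (n + 1)
  have hpc : ∀ n : ℕ, Continuous fun θ : ℝ =>
      Real.posLog ‖(n + 1 : ℂ) * h (circleMap 0 (r n) θ)‖ := by
    intro n
    have : Continuous fun θ => h (circleMap 0 (r n) θ) :=
      hh.continuousOn.comp_continuous (continuous_circleMap 0 _) (hmem n)
    exact Real.continuous_posLog.comp (continuous_const.mul this).norm
  have hψc : ∀ n, Continuous (ψ n) := fun n => continuous_const.sub (hpc n)
  have hψ0 : ∀ n θ, 0 ≤ ψ n θ := by
    intro n θ
    rw [hψ, sub_nonneg]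
    have h1 : ‖(n + 1 : ℂ) * h (circleMap 0 (r n) θ)‖ ≤ n + 1 := by
      rw [norm_mul, hn1]
      exact mul_le_of_le_one_right (by positivity) (hb _ (hmem n θ))
    refine (Real.posLog_le_posLog (norm_nonneg _) h1).trans ?_
    rw [Real.posLog_eq_log]
    rw [abs_of_nonneg (by positivity)]
    simp
  have hint : ∀ n, ∫⁻ θ in Ioc (0 : ℝ) (2 * Real.pi), ENNReal.ofReal (ψ n θ) ≤
      ENNReal.ofReal (2 * Real.pi * -Real.log ‖h 0‖) := by
    intro n
    have hi : IntervalIntegrable (ψ n) volume 0 (2 * Real.pi) := (hψc n).intervalIntegrable _ _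
    rw [← ofReal_integral_eq_lintegral_ofReal
      ((intervalIntegrable_iff_integrableOn_Ioc_of_le (by positivity)).1 hi)
      (ae_of_all _ (hψ0 n)), ← intervalIntegral.integral_of_le (by positivity)]
    refine ENNReal.ofReal_le_ofReal ?_
    have hcl : AnalyticOnNhd ℂ (fun z => (n + 1 : ℂ) * h z) (Metric.closedBall 0 (r n)) :=
      fun z hz => analyticAt_const.mul (han z (Metric.closedBall_subset_ball (hrm n).2 hz))
    have hne : (n + 1 : ℂ) ≠ 0 := by exact_mod_cast Nat.succ_ne_zero n
    have h1 := log_norm_le_circleAverage (hrm n).1 hcl (mul_ne_zero hne h0)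
    have hsph : Metric.sphere (0 : ℂ) |r n| ⊆ Metric.closedBall 0 (r n) := by
      rw [abs_of_pos (hrm n).1]; exact Metric.sphere_subset_closedBall
    have hmer : MeromorphicOn (fun z => (n + 1 : ℂ) * h z) (Metric.sphere 0 |r n|) :=
      (hcl.mono hsph).meromorphicOn
    have h2 : Real.circleAverage (Real.log ‖(n + 1 : ℂ) * h ·‖) 0 (r n) ≤
        Real.circleAverage (fun z => Real.posLog ‖(n + 1 : ℂ) * h z‖) 0 (r n) := by
      refine Real.circleAverage_mono hmer.circleIntegrable_log_norm
        hmer.circleIntegrable_posLog_norm fun z _ => le_max_right _ _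
    have h3 := h1.trans h2
    rw [norm_mul, Real.log_mul (norm_ne_zero_iff.2 hne) (norm_ne_zero_iff.2 h0), hn1,
      Real.circleAverage_def, smul_eq_mul, inv_mul_eq_div, le_div_iff₀ (by positivity)] at h3
    rw [hψ]
    simp only
    rw [intervalIntegral.integral_sub (by simp) ((hpc n).intervalIntegrable _ _)]
    simp only [intervalIntegral.integral_const, smul_eq_mul, sub_zero]
    linarith
  have hmeas : ∀ n, Measurable fun θ => ENNReal.ofReal (ψ n θ) := fun n =>
    (hψc n).measurable.ennreal_ofReal
  have hfin : ∫⁻ θ in Ioc (0 : ℝ) (2 * Real.pi),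
      liminf (fun n => ENNReal.ofReal (ψ n θ)) atTop ≠ ∞ := by
    refine ne_top_of_le_ne_top
      (ENNReal.ofReal_ne_top (r := 2 * Real.pi * -Real.log ‖h 0‖)) ?_
    refine (lintegral_liminf_le hmeas).trans ?_
    exact (liminf_le_liminf (Eventually.of_forall hint)).trans_eq (liminf_const _)
  filter_upwards [ae_lt_top (Measurable.liminf hmeas) hfin] with θ hθ ht
  refine hθ.ne (Tendsto.liminf_eq ?_)
  refine ENNReal.tendsto_ofReal_nhds_top.2 ?_
  rw [tendsto_atTop]
  intro A
  have hr1 : Tendsto r atTop (𝓝[<] 1) :=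
    tendsto_nhdsWithin_iff.2 ⟨hrt, Eventually.of_forall fun n => (hrm n).2⟩
  have ht' := (ht.comp hr1).norm
  rw [norm_zero] at ht'
  have hn : Tendsto (fun n : ℕ => (n : ℝ) + 1) atTop atTop :=
    tendsto_atTop_add_const_right _ _ tendsto_natCast_atTop_atTop
  filter_upwards [ht'.eventually_lt_const (Real.exp_pos (-A)),
    hn.eventually_ge_atTop (Real.exp A)] with n hn1' hn2
  simp only [Function.comp_apply] at hn1'
  have hpos : (0 : ℝ) < n + 1 := by positivity
  rw [hψ, le_sub_comm, Real.posLog_eq_log_max_one (norm_nonneg _)]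
  have h5 : Real.log (n + 1) - A = Real.log ((n + 1) * Real.exp (-A)) := by
    rw [Real.log_mul hpos.ne' (Real.exp_pos _).ne', Real.log_exp]; ring
  rw [h5]
  refine Real.log_le_log (by positivity) (max_le ?_ ?_)
  · rw [Real.exp_neg, ← div_eq_mul_inv, one_le_div (Real.exp_pos _)]
    exact hn2
  · rw [norm_mul, hn1]
    gcongr

/-! ### The Nevanlinna class of the disc -/

/-- On the circle `Re (c ζ^{-m}) = Re (c̄ ζ^m)`, so negative frequencies can be folded onto positive
ones. The free factor `c` carries complex scalars through the span induction. -/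
theorem exists_polynomial_re_eq_of_mem_span {q : C(UnitAddCircle, ℂ)}
    (hq : q ∈ Submodule.span ℂ (range (fourier (T := (1 : ℝ))))) (c : ℂ) :
    ∃ p : Polynomial ℂ, ∀ x : UnitAddCircle,
      (c * q x).re = (p.eval (AddCircle.toCircle x : ℂ)).re := by
  induction hq using Submodule.span_induction generalizing c with
  | mem q hq =>
    obtain ⟨n, rfl⟩ := hq
    rcases Int.eq_nat_or_neg n with ⟨m, rfl | rfl⟩
    · refine ⟨Polynomial.C c * Polynomial.X ^ m, fun x => ?_⟩
      simp [fourier_apply, AddCircle.toCircle_nsmul]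
    · refine ⟨Polynomial.C (starRingEnd ℂ c) * Polynomial.X ^ m, fun x => ?_⟩
      rw [← Complex.conj_re]
      simp only [fourier_neg, map_mul, Complex.conj_conj]
      simp [fourier_apply, AddCircle.toCircle_nsmul]
  | zero => exact ⟨0, by simp⟩
  | add q₁ q₂ _ _ h₁ h₂ =>
    obtain ⟨p₁, hp₁⟩ := h₁ c
    obtain ⟨p₂, hp₂⟩ := h₂ c
    refine ⟨p₁ + p₂, fun x => ?_⟩
    rw [Polynomial.eval_add, Complex.add_re, ← hp₁, ← hp₂, ← Complex.add_re, ← mul_add]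
    rfl
  | smul a q _ h =>
    obtain ⟨p, hp⟩ := h (c * a)
    refine ⟨p, fun x => ?_⟩
    rw [← hp, mul_assoc]
    rfl

/-- Real parts of polynomials are uniformly dense in the continuous functions on the circle. -/
theorem exists_polynomial_abs_re_sub_le {u : ℂ → ℝ} (hu : ContinuousOn u (Metric.sphere 0 1))
    {ε : ℝ} (hε : 0 < ε) :
    ∃ p : Polynomial ℂ, ∀ ζ : ℂ, ‖ζ‖ = 1 → |(p.eval ζ).re - u ζ| ≤ ε := by
  let v : C(UnitAddCircle, ℂ) := ⟨fun x => (u (AddCircle.toCircle x) : ℂ), by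
    refine Complex.continuous_ofReal.comp (hu.comp_continuous ?_ fun x => ?_)
    · exact continuous_subtype_val.comp AddCircle.continuous_toCircle
    · simpa using Circle.norm_coe _⟩
  have hv : v ∈ (Submodule.span ℂ (range (fourier (T := (1 : ℝ))))).topologicalClosure := by
    rw [span_fourier_closure_eq_top]; trivial
  obtain ⟨q, hq, hqv⟩ := Metric.mem_closure_iff.1 hv ε hε
  obtain ⟨p, hp⟩ := exists_polynomial_re_eq_of_mem_span hq 1
  refine ⟨p, fun ζ hζ => ?_⟩
  obtain ⟨x, hx⟩ := (AddCircle.homeomorphCircle (one_ne_zero (α := ℝ))).surjective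
    ⟨ζ, mem_sphere_zero_iff_norm.2 hζ⟩
  have hx' : (AddCircle.toCircle x : ℂ) = ζ := by
    rw [← AddCircle.homeomorphCircle_apply one_ne_zero, hx]
  have h1 := ContinuousMap.dist_apply_le_dist (f := v) (g := q) x
  have h2 : |(v x - q x).re| ≤ ‖v x - q x‖ := Complex.abs_re_le_norm _
  rw [← hx', ← hp x, one_mul, abs_sub_comm]
  rw [Complex.sub_re] at h2
  rw [dist_eq_norm] at h1
  exact h2.trans (h1.trans hqv.le)

/-- A function with small mean of `log⁺` on the circle is bounded after multiplication with a
bounded outer function that is not small at the origin. -/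
theorem exists_bounded_multiplier {φ : ℂ → ℂ} (hφ : DiffContOnCl ℂ φ (Metric.ball 0 1)) {C : ℝ}
    (hC : Real.circleAverage (fun z => Real.posLog ‖φ z‖) 0 1 ≤ C) :
    ∃ h : ℂ → ℂ, Differentiable ℂ h ∧ (∀ z ∈ Metric.ball (0 : ℂ) 1, ‖h z‖ ≤ 1) ∧
      (∀ z ∈ Metric.ball (0 : ℂ) 1, ‖φ z * h z‖ ≤ 1) ∧ Real.exp (-(C + 1)) ≤ ‖h 0‖ := by
  have hcl : closure (Metric.ball (0 : ℂ) 1) = Metric.closedBall 0 1 := closure_ball _ one_ne_zero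
  have hfr : frontier (Metric.ball (0 : ℂ) 1) = Metric.sphere 0 1 := frontier_ball _ one_ne_zero
  have hφc : ContinuousOn φ (Metric.sphere 0 1) :=
    hφ.2.mono (by rw [hcl]; exact Metric.sphere_subset_closedBall)
  have huc : ContinuousOn (fun z => Real.posLog ‖φ z‖) (Metric.sphere 0 1) :=
    Real.continuous_posLog.comp_continuousOn hφc.norm
  -- Approximating `log⁺ |φ| + 1/2` within `1/2` puts `Re p` between `log⁺ |φ|` and `log⁺ |φ| + 1`
  -- on the circle. The multiplier is `exp (-p)`, and the mean value property gives `Re p(0) ≤ C +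
  -- 1`.
  obtain ⟨p, hp⟩ := exists_polynomial_abs_re_sub_le (huc.add (continuousOn_const (c := (1 / 2 : ℝ))))
    (one_half_pos (α := ℝ))
  simp only [Pi.add_apply] at hp
  have hp1 : ∀ ζ : ℂ, ‖ζ‖ = 1 → Real.posLog ‖φ ζ‖ ≤ (p.eval ζ).re := fun ζ hζ => by
    linarith [(abs_le.1 (hp ζ hζ)).1]
  have hp2 : ∀ ζ : ℂ, ‖ζ‖ = 1 → (p.eval ζ).re ≤ Real.posLog ‖φ ζ‖ + 1 := fun ζ hζ => by
    linarith [(abs_le.1 (hp ζ hζ)).2]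
  have hpd : Differentiable ℂ fun z => p.eval z := p.differentiable
  have hhd : Differentiable ℂ fun z => Complex.exp (-p.eval z) := hpd.neg.cexp
  have hnorm : ∀ z, ‖Complex.exp (-p.eval z)‖ = Real.exp (-(p.eval z).re) := fun z => by
    rw [Complex.norm_exp, Complex.neg_re]
  refine ⟨fun z => Complex.exp (-p.eval z), hhd, fun z hz => ?_, fun z hz => ?_, ?_⟩
  · refine Complex.norm_le_of_forall_mem_frontier_norm_le Metric.isBounded_ball hhd.diffContOnCl
      (fun ζ hζ => ?_) (subset_closure hz)
    have hζ : ‖ζ‖ = 1 := by simpa [hfr] using hζ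
    rw [hnorm, Real.exp_le_one_iff]
    linarith [hp1 ζ hζ, Real.posLog_nonneg (x := ‖φ ζ‖)]
  · refine Complex.norm_le_of_forall_mem_frontier_norm_le (f := fun z => φ z * Complex.exp (-p.eval z))
      Metric.isBounded_ball (hφ.smul hhd.diffContOnCl)
      (fun ζ hζ => ?_) (subset_closure hz)
    have hζ : ‖ζ‖ = 1 := by simpa [hfr] using hζ
    rw [norm_mul, hnorm, Real.exp_neg, ← div_eq_mul_inv, div_le_one (Real.exp_pos _)]
    refine (Real.le_exp_log _).trans (Real.exp_le_exp.2 (le_trans (le_max_right _ _) (hp1 ζ hζ)))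
  · simp only [hnorm, Real.exp_le_exp, neg_le_neg_iff]
    have h1 : (p.eval 0).re = Real.circleAverage (fun z => (p.eval z).re) 0 1 := by
      have h2 : DiffContOnCl ℂ (fun z => p.eval z) (Metric.ball 0 |1|) := hpd.diffContOnCl
      have h3 := h2.circleAverage
      have h4 := Complex.reCLM.circleAverage_comp_comm (f := fun z => p.eval z) (c := 0) (R := 1)
        (hpd.continuous.continuousOn.circleIntegrable zero_le_one)
      rw [h3] at h4
      exact h4.symm
    rw [h1]
    refine (Real.circleAverage_mono (f₂ := fun z => Real.posLog ‖φ z‖ + 1) ?_ ?_ ?_).trans ?_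
    · exact (Complex.continuous_re.comp hpd.continuous).continuousOn.circleIntegrable zero_le_one
    · exact (huc.add continuousOn_const).circleIntegrable zero_le_one
    · intro ζ hζ
      exact hp2 ζ (by simpa using hζ)
    · rw [Real.circleAverage_fun_add (huc.circleIntegrable zero_le_one)
        (continuousOn_const.circleIntegrable zero_le_one), Real.circleAverage_const]
      linarith

/-- **Montel's theorem**, for the pointwise limit along an ultrafilter. -/
theorem exists_tendsto_ultrafilter_of_bounded {ι : Type*} (U : Ultrafilter ι) {h : ι → ℂ → ℂ}
    (hd : ∀ i, DifferentiableOn ℂ (h i) (Metric.ball 0 1))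
    (hb : ∀ i, ∀ z ∈ Metric.ball (0 : ℂ) 1, ‖h i z‖ ≤ 1) :
    ∃ g : ℂ → ℂ, DifferentiableOn ℂ g (Metric.ball 0 1) ∧
      ∀ z ∈ Metric.ball (0 : ℂ) 1, Tendsto (fun i => h i z) U (𝓝 (g z)) := by
  -- Taylor coefficients are bounded by 1 by Cauchy's estimates, so each converges along `U`;
  -- dominated convergence then sums the series.
  set a : ι → ℕ → ℂ := fun i n => (n.factorial : ℂ)⁻¹ * iteratedDeriv n (h i) 0 with ha
  have hab : ∀ i n, ‖a i n‖ ≤ 1 := by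
    intro i n
    have h1 : ∀ R ∈ Ioo (0 : ℝ) 1, ‖a i n‖ * R ^ n ≤ 1 := by
      intro R hR
      have hsub : Metric.closedBall (0 : ℂ) R ⊆ Metric.ball 0 1 :=
        Metric.closedBall_subset_ball hR.2
      have h2 := Complex.norm_iteratedDeriv_le_of_forall_mem_sphere_norm_le n hR.1
        (((hd i).mono hsub).diffContOnCl_ball Subset.rfl)
        (fun z hz => hb i z (hsub (Metric.sphere_subset_closedBall hz)))
      have hf : (0 : ℝ) < n.factorial := by positivity
      rw [mul_one, le_div_iff₀ (pow_pos hR.1 n)] at h2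
      rw [ha]
      simp only [norm_mul, norm_inv, Complex.norm_natCast]
      rw [mul_assoc, inv_mul_le_iff₀ hf, mul_one]
      exact h2
    have h3 : Tendsto (fun R : ℝ => ‖a i n‖ * R ^ n) (𝓝[<] 1) (𝓝 (‖a i n‖ * 1 ^ n)) :=
      Tendsto.mono_left (Continuous.tendsto (by fun_prop) _) nhdsWithin_le_nhds
    have := le_of_tendsto h3 (by
      filter_upwards [Ioo_mem_nhdsLT zero_lt_one] with R hR using h1 R hR)
    simpa using this
  have hlim : ∀ n, ∃ b : ℂ, Tendsto (fun i => a i n) U (𝓝 b) := by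
    intro n
    obtain ⟨b, -, hbt⟩ := (isCompact_closedBall (0 : ℂ) 1).ultrafilter_le_nhds
      (U.map fun i => a i n) (by
        rw [le_principal_iff]
        exact Filter.mem_map.2 (Filter.univ_mem' fun i => by simpa using hab i n))
    exact ⟨b, hbt⟩
  choose b hbt using hlim
  have hbb : ∀ n, ‖b n‖ ≤ 1 := fun n =>
    le_of_tendsto (hbt n).norm (Eventually.of_forall fun i => hab i n)
  refine ⟨fun z => ∑' n, b n * z ^ n, ?_, fun z hz => ?_⟩
  · intro z hz
    have hz1 : ‖z‖ < 1 := by simpa using hz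
    obtain ⟨ρ, hzρ, hρ⟩ := exists_between hz1
    have hρ0 : 0 ≤ ρ := (norm_nonneg z).trans hzρ.le
    have := Complex.differentiableOn_tsum_of_summable_norm (F := fun n z => b n * z ^ n)
      (U := Metric.ball 0 ρ) (summable_geometric_of_lt_one hρ0 hρ) (fun n => by fun_prop)
      Metric.isOpen_ball (fun n w hw => by
        have hw : ‖w‖ < ρ := by simpa using hw
        rw [norm_mul, norm_pow]
        calc ‖b n‖ * ‖w‖ ^ n ≤ 1 * ρ ^ n := by gcongr; exact hbb n
          _ = ρ ^ n := one_mul _)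
    exact (this.differentiableAt
      (Metric.isOpen_ball.mem_nhds (by simpa using hzρ))).differentiableWithinAt
  · have hz1 : ‖z‖ < 1 := by simpa using hz
    have h1 : (fun i => h i z) = fun i => ∑' n, a i n * z ^ n := by
      funext i
      have := Complex.taylorSeries_eq_on_ball' hz (hd i)
      simpa only [sub_zero] using this.symm
    rw [h1]
    refine tendsto_tsum_of_dominated_convergence
      (summable_geometric_of_lt_one (norm_nonneg z) hz1) (fun n => (hbt n).mul_const _)
      (Eventually.of_forall fun i n => ?_)
    rw [norm_mul, norm_pow]
    calc ‖a i n‖ * ‖z‖ ^ n ≤ 1 * ‖z‖ ^ n := by gcongr; exact hab i n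
      _ = ‖z‖ ^ n := one_mul _

/-- A function of the Nevanlinna class of the disc is a quotient of bounded functions. -/
theorem exists_bounded_quotient {f : ℂ → ℂ} (hf : DifferentiableOn ℂ f (Metric.ball 0 1))
    {r : ℕ → ℝ} (hr : ∀ n, r n ∈ Ioo (0 : ℝ) 1) (hrt : Tendsto r atTop (𝓝 1)) {C : ℝ}
    (hC : ∃ᶠ n in atTop, Real.circleAverage (fun z => Real.posLog ‖f z‖) 0 (r n) ≤ C) :
    ∃ h : ℂ → ℂ, DifferentiableOn ℂ h (Metric.ball 0 1) ∧
      (∀ z ∈ Metric.ball (0 : ℂ) 1, ‖h z‖ ≤ 1) ∧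
      (∀ z ∈ Metric.ball (0 : ℂ) 1, ‖f z * h z‖ ≤ 1) ∧ h 0 ≠ 0 := by
  have hmul : ∀ n, ∃ h : ℂ → ℂ, Differentiable ℂ h ∧ (∀ z ∈ Metric.ball (0 : ℂ) 1, ‖h z‖ ≤ 1) ∧
      (Real.circleAverage (fun z => Real.posLog ‖f z‖) 0 (r n) ≤ C →
        (∀ z ∈ Metric.ball (0 : ℂ) 1, ‖f (r n * z) * h z‖ ≤ 1) ∧ Real.exp (-(C + 1)) ≤ ‖h 0‖) := by
    intro n
    by_cases hn : Real.circleAverage (fun z => Real.posLog ‖f z‖) 0 (r n) ≤ C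
    swap
    -- At indices with a large mean any bounded function will do: the ultrafilter chosen below
    -- ignores them.
    · exact ⟨0, differentiable_const _, by simp, fun h => absurd h hn⟩
    have hφ : DiffContOnCl ℂ (fun z => f (r n * z)) (Metric.ball 0 1) := by
      have h1 : DifferentiableOn ℂ (fun z => f (r n * z)) (Metric.closedBall 0 1) := by
        refine hf.comp (by fun_prop) fun z hz => ?_
        have hz : ‖z‖ ≤ 1 := by simpa using hz
        simp only [Metric.mem_ball, dist_zero_right, norm_mul, Complex.norm_real,
          Real.norm_of_nonneg (hr n).1.le]
        nlinarith [(hr n).1, (hr n).2]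
      exact h1.diffContOnCl_ball Subset.rfl
    obtain ⟨h, h1, h2, h3, h4⟩ := exists_bounded_multiplier hφ (C := C) (by
      rw [Real.circleAverage_eq_circleAverage_zero_one] at hn
      simpa using hn)
    exact ⟨h, h1, h2, fun _ => ⟨h3, h4⟩⟩
  choose h hd hb hh using hmul
  obtain ⟨U, hU, hUC⟩ : ∃ U : Ultrafilter ℕ, (U : Filter ℕ) ≤ atTop ∧
      ∀ᶠ n in (U : Filter ℕ), Real.circleAverage (fun z => Real.posLog ‖f z‖) 0 (r n) ≤ C := by
    have hne := frequently_iff_neBot.1 hC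
    have hle := Ultrafilter.of_le (atTop ⊓ 𝓟 {n | Real.circleAverage
      (fun z => Real.posLog ‖f z‖) 0 (r n) ≤ C})
    exact ⟨_, hle.trans inf_le_left, hle.trans inf_le_right (mem_principal_self _)⟩
  obtain ⟨g, hg, hgt⟩ := exists_tendsto_ultrafilter_of_bounded U
    (fun n => (hd n).differentiableOn) hb
  refine ⟨g, hg, fun z hz => ?_, fun z hz => ?_, ?_⟩
  · exact le_of_tendsto (hgt z hz).norm (Eventually.of_forall fun n => hb n z hz)
  · have h1 : Tendsto (fun n => f (r n * z)) U (𝓝 (f z)) := by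
      have h2 : ContinuousAt f z := (hf.differentiableAt (Metric.isOpen_ball.mem_nhds hz)).continuousAt
      refine h2.tendsto.comp ?_
      have h3 : Tendsto (fun n => (r n : ℂ) * z) atTop (𝓝 ((1 : ℝ) * z)) :=
        ((Complex.continuous_ofReal.tendsto 1).comp hrt).mul_const z
      simp only [Complex.ofReal_one, one_mul] at h3
      exact h3.mono_left hU
    refine le_of_tendsto (h1.mul (hgt z hz)).norm ?_
    filter_upwards [hUC] with n hn using (hh n hn).1 z hz
  · have h1 : Real.exp (-(C + 1)) ≤ ‖g 0‖ := by
      refine ge_of_tendsto (hgt 0 (by simp)).norm ?_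
      filter_upwards [hUC] with n hn using (hh n hn).2
    exact norm_pos_iff.1 ((Real.exp_pos _).trans_le h1)

/-- **Fatou's theorem** for the Nevanlinna class of the disc. -/
theorem ae_tendsto_circleMap_of_nevanlinna {f : ℂ → ℂ}
    (hf : DifferentiableOn ℂ f (Metric.ball 0 1))
    {r : ℕ → ℝ} (hr : ∀ n, r n ∈ Ioo (0 : ℝ) 1) (hrt : Tendsto r atTop (𝓝 1)) {C : ℝ}
    (hC : ∃ᶠ n in atTop, Real.circleAverage (fun z => Real.posLog ‖f z‖) 0 (r n) ≤ C) :
    ∀ᵐ θ ∂(volume.restrict (Ioc (0 : ℝ) (2 * Real.pi))),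
      ∃ c, Tendsto (fun r : ℝ => f (circleMap 0 r θ)) (𝓝[<] 1) (𝓝 c) := by
  obtain ⟨h, hd, hb, hfh, h0⟩ := exists_bounded_quotient hf hr hrt hC
  filter_upwards [ae_restrict_of_ae (ae_tendsto_circleMap_of_bounded hd hb),
    ae_restrict_of_ae (ae_tendsto_circleMap_of_bounded (hf.mul hd) hfh),
    ae_not_tendsto_zero_of_bounded hd hb h0] with θ ⟨c, hc⟩ ⟨c', hc'⟩ hn
  have hc0 : c ≠ 0 := by
    rintro rfl
    exact hn hc
  refine ⟨c' / c, (hc'.div hc hc0).congr' ?_⟩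
  filter_upwards [hc.eventually_ne hc0] with s hs
  simp [mul_div_cancel_right₀ _ hs]

/-! ### Holomorphic functions on open subsets of a Banach space -/

/-- Coordinates of a point of `ℓ¹` tend to 0, so in the domain they are all below some `m < 1`, and
each coordinate is dominated by the norm. -/
theorem isOpen_polydisk : IsOpen polydisk := by
  rw [Metric.isOpen_iff]
  intro ζ hζ
  have hsum : Summable fun n => ‖ζ n‖ := by
    simpa using (lp.memℓp ζ).summable (by norm_num : 0 < (1 : ℝ≥0∞).toReal)
  obtain ⟨N, hN⟩ := eventually_atTop.1
    (hsum.tendsto_atTop_zero.eventually_lt_const (one_half_pos (α := ℝ)))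
  have h1 : ∀ᶠ m in 𝓝[<] (1 : ℝ), ∀ n ∈ Finset.range N, ‖ζ n‖ < m :=
    (Filter.eventually_all_finset _).2 fun n _ =>
      Filter.Eventually.filter_mono nhdsWithin_le_nhds (lt_mem_nhds (hζ n))
  have h2 : ∀ᶠ m in 𝓝[<] (1 : ℝ), 1 / 2 < m :=
    Filter.Eventually.filter_mono nhdsWithin_le_nhds (lt_mem_nhds (by norm_num))
  obtain ⟨m, hm, hm2, hm1⟩ := (h1.and (h2.and self_mem_nhdsWithin)).exists
  refine ⟨1 - m, sub_pos.2 hm1, fun η hη n => ?_⟩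
  have h3 : ‖ζ n‖ < m := by
    rcases lt_or_ge n N with h | h
    · exact hm n (Finset.mem_range.2 h)
    · exact (hN n h).trans hm2
  have h4 : ‖(η - ζ) n‖ ≤ ‖η - ζ‖ := lp.norm_apply_le_norm one_ne_zero _ n
  rw [Metric.mem_ball, dist_eq_norm] at hη
  have h5 : ‖η n‖ ≤ ‖ζ n‖ + ‖(η - ζ) n‖ := by
    have := norm_add_le (ζ n) ((η - ζ) n)
    simpa using this
  linarith

section Holomorphic

variable {X : Type*} [NormedAddCommGroup X] [NormedSpace ℂ X] {F : X → ℂ} {V : Set X}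

/-- Holomorphic functions are locally Lipschitz. -/
theorem IsHolomorphicOn.exists_lipschitz (hF : IsHolomorphicOn F V) (hV : IsOpen V) {x₀ : X}
    (hx₀ : x₀ ∈ V) : ∃ ρ > 0, ∃ K : ℝ, Metric.ball x₀ ρ ⊆ V ∧
      ∀ x ∈ Metric.ball x₀ ρ, ∀ y ∈ Metric.ball x₀ ρ, ‖F y - F x‖ ≤ K * ‖y - x‖ := by
  obtain ⟨M, hM⟩ := hF.1 x₀ hx₀
  rw [hV.nhdsWithin_eq hx₀] at hM
  obtain ⟨ρ, hρ, hball⟩ := Metric.eventually_nhds_iff_ball.1 (hM.and (hV.mem_nhds hx₀))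
  refine ⟨ρ / 4, by positivity, 2 * M / (ρ / 2), fun x hx => (hball x
    (Metric.ball_subset_ball (by linarith) hx)).2, fun x hx y hy => ?_⟩
  rw [Metric.mem_ball, dist_eq_norm] at hx hy
  rcases eq_or_ne y x with rfl | hxy
  · simp
  have hn : 0 < ‖y - x‖ := norm_pos_iff.2 (sub_ne_zero.2 hxy)
  have hlt : ‖y - x‖ < ρ / 2 := by
    have := norm_sub_le_norm_sub_add_norm_sub y x₀ x
    rw [norm_sub_rev x₀ x] at this
    linarith
  -- On the complex line through `x` in this unit direction, `F` stays within `2 * M` of `F x` on a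
  -- disc of radius `ρ / 2`. Schwarz's lemma at the parameter `‖y - x‖` gives the bound.
  set v : X := ((‖y - x‖ : ℂ))⁻¹ • (y - x) with hv
  have hvn : ‖v‖ = 1 := by
    rw [hv, norm_smul, norm_inv, Complex.norm_real, norm_norm, inv_mul_cancel₀ hn.ne']
  have hmem : ∀ z ∈ Metric.ball (0 : ℂ) (ρ / 2), x + z • v ∈ Metric.ball x₀ ρ := by
    intro z hz
    have hz : ‖z‖ < ρ / 2 := by simpa using hz
    rw [Metric.mem_ball, dist_eq_norm]
    have : x + z • v - x₀ = (x - x₀) + z • v := by abel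
    rw [this]
    refine (norm_add_le _ _).trans_lt ?_
    rw [norm_smul, hvn, mul_one]
    linarith
  have hd : DifferentiableOn ℂ (fun z : ℂ => F (x + z • v)) (Metric.ball 0 (ρ / 2)) :=
    (hF.2 x (hball x (by rw [Metric.mem_ball, dist_eq_norm]; linarith)).2 v).mono
      fun z hz => (hball _ (hmem z hz)).2
  have hmaps : MapsTo (fun z : ℂ => F (x + z • v)) (Metric.ball 0 (ρ / 2))
      (Metric.closedBall (F (x + (0 : ℂ) • v)) (2 * M)) := by
    intro z hz
    rw [Metric.mem_closedBall, dist_eq_norm]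
    refine (norm_sub_le _ _).trans ?_
    have h1 := (hball _ (hmem z hz)).1
    have h2 := (hball _ (hmem 0 (by simp [hρ]))).1
    linarith
  have := Complex.dist_le_div_mul_dist_of_mapsTo_ball hd hmaps (z := (‖y - x‖ : ℂ)) (by simpa using hlt)
  have hy' : x + (‖y - x‖ : ℂ) • v = y := by
    rw [hv, smul_smul, mul_inv_cancel₀ (by exact_mod_cast hn.ne'), one_smul, add_sub_cancel]
  simpa only [hy', dist_eq_norm, zero_smul, add_zero, sub_zero, Complex.norm_real, norm_norm]
    using this

theorem IsHolomorphicOn.continuousAt (hF : IsHolomorphicOn F V) (hV : IsOpen V) {x₀ : X}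
    (hx₀ : x₀ ∈ V) : ContinuousAt F x₀ := by
  obtain ⟨ρ, hρ, K, -, hK⟩ := hF.exists_lipschitz hV hx₀
  rw [ContinuousAt, tendsto_iff_norm_sub_tendsto_zero]
  have h1 : Tendsto (fun x => K * ‖x - x₀‖) (𝓝 x₀) (𝓝 (K * ‖x₀ - x₀‖)) :=
    Continuous.tendsto (by fun_prop) _
  rw [sub_self, norm_zero, mul_zero] at h1
  refine squeeze_zero' (Eventually.of_forall fun _ => norm_nonneg _) ?_ h1
  filter_upwards [Metric.ball_mem_nhds x₀ hρ] with x hx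
  exact hK x₀ (Metric.mem_ball_self hρ) x hx

/-- The composition of a holomorphic function with a complex differentiable curve is complex
differentiable. -/
theorem IsHolomorphicOn.differentiableAt_comp (hF : IsHolomorphicOn F V) (hV : IsOpen V)
    {γ : ℂ → X} {z₀ : ℂ} (hγ : DifferentiableAt ℂ γ z₀) (hz₀ : γ z₀ ∈ V) :
    DifferentiableAt ℂ (fun z => F (γ z)) z₀ := by
  obtain ⟨ρ, hρ, K, hsub, hK⟩ := hF.exists_lipschitz hV hz₀
  set v : X := deriv γ z₀
  -- Along the tangent line, `F` is differentiable by definition; the Lipschitz bound makes the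
  -- error of replacing `γ` by `ℓ` negligible.
  set ℓ : ℂ → X := fun z => γ z₀ + (z - z₀) • v with hℓ
  have hℓc : Continuous ℓ := by fun_prop
  have hℓ0 : ℓ z₀ = γ z₀ := by simp [hℓ]
  have hopen : IsOpen {z : ℂ | γ z₀ + z • v ∈ V} := hV.preimage (by fun_prop)
  have h1 : DifferentiableAt ℂ (fun z : ℂ => F (γ z₀ + z • v)) 0 :=
    (hF.2 _ hz₀ v).differentiableAt (hopen.mem_nhds (by simpa using hz₀))
  have h2 : DifferentiableAt ℂ (fun z : ℂ => F (ℓ z)) z₀ := by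
    have h1' : DifferentiableAt ℂ (fun z : ℂ => F (γ z₀ + z • v)) (z₀ - z₀) := by rwa [sub_self]
    exact h1'.comp z₀ (f := fun z => z - z₀) (by fun_prop)
  have h3 := h2.hasDerivAt
  refine HasDerivAt.differentiableAt (f' := deriv (fun z => F (ℓ z)) z₀) ?_
  rw [hasDerivAt_iff_isLittleO] at h3 ⊢
  have h4 : (fun z => γ z - ℓ z) =o[𝓝 z₀] fun z => z - z₀ := by
    have := hasDerivAt_iff_isLittleO.1 hγ.hasDerivAt
    refine this.congr_left fun z => ?_
    simp only [hℓ, v]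
    abel
  have h5 : (fun z => F (γ z) - F (ℓ z)) =o[𝓝 z₀] fun z => z - z₀ := by
    refine Asymptotics.IsBigO.trans_isLittleO (Asymptotics.IsBigO.of_bound K ?_) h4
    have e1 : ∀ᶠ z in 𝓝 z₀, γ z ∈ Metric.ball (γ z₀) ρ :=
      hγ.continuousAt.eventually (Metric.ball_mem_nhds _ hρ)
    have e2 : ∀ᶠ z in 𝓝 z₀, ℓ z ∈ Metric.ball (γ z₀) ρ :=
      hℓc.continuousAt.eventually (by rw [hℓ0]; exact Metric.ball_mem_nhds _ hρ)
    filter_upwards [e1, e2] with z hz1 hz2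
    exact hK _ hz2 _ hz1
  refine (h5.add h3).congr_left fun z => ?_
  rw [hℓ0]
  ring

end Holomorphic

/-! ### Slices of the polydisc and rotations of the torus -/

/-- The curve `z ↦ (z w₁, z² w₂, …)`. -/
noncomputable def torusCurve (w : Torus) (z : ℂ) : EllOne :=
  ∑' n : ℕ, (z ^ (n + 1) * (w n : ℂ)) • lp.single 1 n (1 : ℂ)

/-- A geometric majorant uniform in `w`: the Weierstrass test yields both holomorphy in `z` and
joint continuity in `(z, w)`. -/
theorem norm_torusCurve_term_le (w : Torus) {z : ℂ} {ρ : ℝ} (hz : ‖z‖ ≤ ρ) (n : ℕ) :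
    ‖(z ^ (n + 1) * (w n : ℂ)) • (lp.single 1 n (1 : ℂ) : EllOne)‖ ≤ ρ ^ (n + 1) := by
  rw [norm_smul, norm_mul, norm_pow, Circle.norm_coe, lp.norm_single zero_lt_one, norm_one,
    mul_one, mul_one]
  gcongr

theorem summable_pow_succ {ρ : ℝ} (h0 : 0 ≤ ρ) (h1 : ρ < 1) : Summable fun n : ℕ => ρ ^ (n + 1) :=
  (summable_nat_add_iff 1).2 (summable_geometric_of_lt_one h0 h1)

theorem torusCurve_apply (w : Torus) {z : ℂ} (hz : ‖z‖ < 1) (n : ℕ) :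
    torusCurve w z n = z ^ (n + 1) * (w n : ℂ) := by
  have h : Memℓp (fun n : ℕ => z ^ (n + 1) * (w n : ℂ)) 1 := by
    refine memℓp_gen ?_
    simpa [Circle.norm_coe] using summable_pow_succ (norm_nonneg z) hz
  have h1 := (lp.hasSum_single ENNReal.one_ne_top (⟨_, h⟩ : EllOne)).tsum_eq
  have h2 : torusCurve w z = ⟨_, h⟩ := by
    rw [← h1, torusCurve]
    congr 1
    funext n
    rw [← lp.single_smul, smul_eq_mul, mul_one]
  rw [h2]

theorem torusCurve_mem_polydisk (w : Torus) {z : ℂ} (hz : ‖z‖ < 1) : torusCurve w z ∈ polydisk := by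
  intro n
  rw [torusCurve_apply w hz, norm_mul, norm_pow, Circle.norm_coe, mul_one]
  exact pow_lt_one₀ (norm_nonneg z) hz (Nat.succ_ne_zero n)

theorem differentiableAt_torusCurve (w : Torus) {z : ℂ} (hz : ‖z‖ < 1) :
    DifferentiableAt ℂ (torusCurve w) z := by
  obtain ⟨ρ, hzρ, hρ⟩ := exists_between hz
  have := Complex.differentiableOn_tsum_of_summable_norm
    (F := fun (n : ℕ) (z : ℂ) => (z ^ (n + 1) * (w n : ℂ)) • (lp.single 1 n (1 : ℂ) : EllOne))
    (U := Metric.ball 0 ρ) (summable_pow_succ ((norm_nonneg z).trans hzρ.le) hρ)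
    (fun n => by fun_prop) Metric.isOpen_ball
    (fun n x hx => norm_torusCurve_term_le w (le_of_lt (by simpa using hx)) n)
  exact this.differentiableAt (Metric.isOpen_ball.mem_nhds (by simpa using hzρ))

theorem continuousOn_torusCurve {ρ : ℝ} (h0 : 0 ≤ ρ) (h1 : ρ < 1) :
    ContinuousOn (fun p : ℂ × Torus => torusCurve p.2 p.1) (Metric.closedBall 0 ρ ×ˢ univ) := by
  refine continuousOn_tsum (fun n => ?_) (summable_pow_succ h0 h1) (fun n p hp =>
    norm_torusCurve_term_le p.2 (by simpa using hp.1) n)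
  have h : Continuous fun p : ℂ × Torus => p.1 ^ (n + 1) * (p.2 n : ℂ) :=
    (continuous_fst.pow _).mul
      (continuous_subtype_val.comp ((continuous_apply n).comp continuous_snd))
  exact (h.smul (continuous_const (y := (lp.single 1 n (1 : ℂ) : EllOne)))).continuousOn

theorem dilate_eq_torusCurve {r : ℝ} (hr : r ∈ Ioo (0 : ℝ) 1) (w : Torus) :
    dilate r w = torusCurve w r := by
  ext n
  rw [dilate_apply hr, torusCurve_apply]
  rw [Complex.norm_real, Real.norm_of_nonneg hr.1.le]
  exact hr.2

/-- The rotation `(w₁, w₂, …) ↦ (u w₁, u² w₂, …)` of the torus. -/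
noncomputable def rotate (u : Circle) (w : Torus) : Torus := fun n => u ^ (n + 1) * w n

theorem continuous_rotate : Continuous fun p : Circle × Torus => rotate p.1 p.2 := by
  refine continuous_pi fun n => ?_
  exact (continuous_fst.pow _).mul ((continuous_apply n).comp continuous_snd)

/-- The weights `r^(n+1)` and the rotations `e^{i(n+1)θ}` have matching exponents, so they combine
into powers of `r e^{iθ}`. This identifies radial limits at rotated points with those of a slice. -/
theorem dilate_rotate {r : ℝ} (hr : r ∈ Ioo (0 : ℝ) 1) (θ : ℝ) (w : Torus) :
    dilate r (rotate (Circle.exp θ) w) = torusCurve w (circleMap 0 r θ) := by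
  ext n
  rw [dilate_apply hr, torusCurve_apply]
  · simp [rotate, circleMap, mul_pow, mul_assoc]
  · simpa [abs_of_pos hr.1] using hr.2

variable {F : EllOne → ℂ}

theorem continuous_radial (hF : IsHolomorphicOn F polydisk) {r : ℝ} (hr : r ∈ Ioo (0 : ℝ) 1) :
    Continuous (radial F r) := by
  have h1 : Continuous fun w : Torus => torusCurve w r := by
    have := continuousOn_torusCurve hr.1.le hr.2
    exact this.comp_continuous (f := fun w : Torus => ((r : ℂ), w)) (by fun_prop)
      (fun w => ⟨by simp [abs_of_pos hr.1], trivial⟩)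
  have h2 : radial F r = fun w => F (torusCurve w r) := by
    funext w
    rw [radial, dilate_eq_torusCurve hr]
  rw [h2]
  refine continuous_iff_continuousAt.2 fun w => ?_
  refine ContinuousAt.comp (g := F) (hF.continuousAt isOpen_polydisk ?_) h1.continuousAt
  rw [← dilate_eq_torusCurve hr]
  exact dilate_mem_polydisk hr w

theorem continuousOn_radial (hF : IsHolomorphicOn F polydisk) (w : Torus) :
    ContinuousOn (fun r => radial F r w) (Ioo 0 1) := by
  have h1 : ContinuousOn (fun r : ℝ => F (torusCurve w r)) (Ioo 0 1) := by
    intro r hr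
    have hn : ‖(r : ℂ)‖ < 1 := by simpa [abs_of_pos hr.1] using hr.2
    refine ContinuousAt.continuousWithinAt ?_
    refine ContinuousAt.comp (g := F) (hF.continuousAt isOpen_polydisk
      (torusCurve_mem_polydisk w hn)) ?_
    exact ContinuousAt.comp (g := torusCurve w) (differentiableAt_torusCurve w hn).continuousAt
      Complex.continuous_ofReal.continuousAt
  refine h1.congr fun r hr => ?_
  rw [radial, dilate_eq_torusCurve hr]

/-- The functions `F_[r]` are uniformly bounded for `r` away from `1`. -/
theorem exists_norm_radial_le (hF : IsHolomorphicOn F polydisk) {ρ : ℝ} (h0 : 0 ≤ ρ) (h1 : ρ < 1) :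
    ∃ M : ℝ, ∀ r ∈ Ioo (0 : ℝ) 1, r ≤ ρ → ∀ w, ‖radial F r w‖ ≤ M := by
  have hc : ContinuousOn (fun p : ℂ × Torus => F (torusCurve p.2 p.1))
      (Metric.closedBall 0 ρ ×ˢ univ) := by
    intro p hp
    have hp1 : ‖p.1‖ ≤ ρ := by simpa using hp.1
    exact ContinuousAt.comp_continuousWithinAt (g := F) (hF.continuousAt isOpen_polydisk
      (torusCurve_mem_polydisk p.2 (hp1.trans_lt h1))) (continuousOn_torusCurve h0 h1 p hp)
  obtain ⟨M, hM⟩ := ((isCompact_closedBall (0 : ℂ) ρ).prod isCompact_univ).exists_bound_of_continuousOn hc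
  refine ⟨M, fun r hr hrρ w => ?_⟩
  rw [radial, dilate_eq_torusCurve hr]
  exact hM (r, w) ⟨by simpa [abs_of_pos hr.1] using hrρ, trivial⟩

theorem differentiableOn_comp_torusCurve (hF : IsHolomorphicOn F polydisk) (w : Torus) :
    DifferentiableOn ℂ (fun z => F (torusCurve w z)) (Metric.ball 0 1) := by
  intro z hz
  have hz : ‖z‖ < 1 := by simpa using hz
  exact (hF.differentiableAt_comp isOpen_polydisk (differentiableAt_torusCurve w hz)
    (torusCurve_mem_polydisk w hz)).differentiableWithinAt

/-! ### Rotation invariance and radial limits on the torus -/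

/-- Invariance is transported from Haar measure on `AddCircle (2 * Real.pi)`, of which
`circleMeasure` is a normalized image. -/
theorem measurePreserving_mul_circleMeasure (v : Circle) :
    MeasurePreserving (fun u => v * u) circleMeasure circleMeasure := by
  have : Fact (0 < 2 * Real.pi) := ⟨Real.two_pi_pos⟩
  have hmk := AddCircle.measurePreserving_mk (2 * Real.pi) 0
  rw [zero_add] at hmk
  have hm : Measurable (AddCircle.homeomorphCircle') := AddCircle.homeomorphCircle'.continuous.measurable
  have hc : circleMeasure = (ENNReal.ofReal (2 * Real.pi))⁻¹ •
      (volume : Measure (AddCircle (2 * Real.pi))).map AddCircle.homeomorphCircle' := by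
    rw [circleMeasure, Measure.map_smul, ← hmk.map_eq, Measure.map_map hm hmk.measurable]
    rfl
  have hv : Measurable fun u : Circle => v * u := (continuous_const.mul continuous_id).measurable
  refine ⟨hv, ?_⟩
  obtain ⟨a, ha⟩ := AddCircle.homeomorphCircle'.surjective v
  rw [hc, Measure.map_smul, Measure.map_map hv hm]
  congr 1
  have h1 : (fun u : Circle => v * u) ∘ AddCircle.homeomorphCircle' =
      AddCircle.homeomorphCircle' ∘ fun x => a + x := by
    funext x
    simp only [Function.comp_apply, ← ha]
    induction a using QuotientAddGroup.induction_on
    induction x using QuotientAddGroup.induction_on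
    exact (Circle.exp_add _ _).symm
  rw [h1, ← Measure.map_map hm (measurable_const_add a), map_add_left_eq_self]

theorem measurePreserving_rotate (u : Circle) :
    MeasurePreserving (rotate u) torusMeasure torusMeasure := by
  have hm : Measurable (rotate u) := by
    refine measurable_pi_lambda _ fun n => ?_
    exact (measurePreserving_mul_circleMeasure (u ^ (n + 1))).measurable.comp (measurable_pi_apply n)
  refine ⟨hm, ?_⟩
  have := Measure.infinitePi_map_pi (μ := fun _ : ℕ => circleMeasure)
    (f := fun n v => u ^ (n + 1) * v)
    (fun n => (measurePreserving_mul_circleMeasure (u ^ (n + 1))).measurable)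
  simp only [(measurePreserving_mul_circleMeasure _).map_eq] at this
  exact this

instance : IsProbabilityMeasure torusMeasure := by
  unfold torusMeasure
  infer_instance

/-- For a continuous function, convergence at the right end point of an interval may be tested on
the rational numbers. -/
theorem tendsto_nhdsLT_iff_rat {Y : Type*} [TopologicalSpace Y] [RegularSpace Y] {g : ℝ → Y}
    (hg : ContinuousOn g (Ioo 0 1)) {c : Y} :
    Tendsto g (𝓝[<] 1) (𝓝 c) ↔
      Tendsto (fun q : ℚ => g q) (comap ((↑) : ℚ → ℝ) (𝓝[<] 1)) (𝓝 c) := by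
  refine ⟨fun h => h.comp tendsto_comap, fun h => ?_⟩
  rw [(closed_nhds_basis c).tendsto_right_iff]
  rintro C ⟨hC, hCc⟩
  obtain ⟨S, hS, hSC⟩ := mem_comap.1 (h hC)
  obtain ⟨a, ha, haS⟩ := (mem_nhdsLT_iff_exists_Ioo_subset' (zero_lt_one (α := ℝ))).1 hS
  filter_upwards [Ioo_mem_nhdsLT zero_lt_one, Ioo_mem_nhdsLT ha] with r hr hra
  -- If `g r` missed the closed set `C`, so would `g` on a neighbourhood of `r`, which contains a
  -- rational.
  by_contra hrC
  have h1 : ∀ᶠ s in 𝓝 r, g s ∉ C :=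
    (hg.continuousAt (isOpen_Ioo.mem_nhds hr)).eventually (hCc.isOpen_compl.mem_nhds hrC)
  obtain ⟨O, hO, hOo, hrO⟩ := eventually_nhds_iff.1 (h1.and (isOpen_Ioo.mem_nhds hra))
  obtain ⟨q, hq⟩ := Rat.denseRange_cast.exists_mem_open hOo ⟨r, hrO⟩
  exact (hO q hq).1 (hSC (haS (hO q hq).2))

variable {F : EllOne → ℂ}

/-- Continuity in `r` reduces the limit to rational radii, a countable family. Outside `(0, 1)` that
family is set to 0 to keep it measurable. -/
theorem measurableSet_exists_tendsto_radial (hF : IsHolomorphicOn F polydisk) :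
    MeasurableSet {w | ∃ c, Tendsto (fun r => radial F r w) (𝓝[<] 1) (𝓝 c)} := by
  classical
  set f : ℚ → Torus → ℂ := fun q w => if (q : ℝ) ∈ Ioo (0 : ℝ) 1 then radial F q w else 0 with hf
  have hfm : ∀ q, Measurable (f q) := by
    intro q
    by_cases hq : (q : ℝ) ∈ Ioo (0 : ℝ) 1
    · simpa only [hf, if_pos hq] using (continuous_radial hF hq).measurable
    · simpa only [hf, if_neg hq] using measurable_const
  convert measurableSet_exists_tendsto (l := comap ((↑) : ℚ → ℝ) (𝓝[<] 1)) hfm using 4 with w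
  funext c
  rw [tendsto_nhdsLT_iff_rat (continuousOn_radial hF w)]
  refine propext (tendsto_congr' ?_)
  filter_upwards [preimage_mem_comap (Ioo_mem_nhdsLT (zero_lt_one (α := ℝ)))] with q hq
  exact (if_pos hq).symm

/-- A function of the Nevanlinna class has radial limits almost everywhere. -/
theorem ae_exists_tendsto_radial (hF : F ∈ nevanlinnaClass) :
    ∀ᵐ w ∂torusMeasure, ∃ c, Tendsto (fun r => radial F r w) (𝓝[<] 1) (𝓝 c) := by
  obtain ⟨hFh, hFb⟩ := hF
  set ν : Measure ℝ := volume.restrict (Ioc 0 (2 * Real.pi)) with hν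
  have hν0 : ν univ = ENNReal.ofReal (2 * Real.pi) := by simp [hν]
  obtain ⟨r, -, hr, hrt⟩ := exists_seq_strictMono_tendsto' (zero_lt_one (α := ℝ))
  have hrot : Continuous fun p : ℝ × Torus => rotate (Circle.exp p.1) p.2 :=
    continuous_rotate.comp ((Circle.exp.continuous.comp continuous_fst).prodMk continuous_snd)
  set φ : ℕ → ℝ → Torus → ℝ := fun n θ w =>
    Real.posLog ‖radial F (r n) (rotate (Circle.exp θ) w)‖ with hφ
  have hφc : ∀ n, Continuous fun p : ℝ × Torus => φ n p.1 p.2 := fun n =>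
    Real.continuous_posLog.comp ((continuous_radial hFh (hr n)).comp hrot).norm
  set I : ℕ → Torus → ℝ≥0∞ := fun n w => ∫⁻ θ, ENNReal.ofReal (φ n θ w) ∂ν with hI
  have hIm : ∀ n, Measurable (I n) := fun n =>
    Measurable.lintegral_prod_left' (hφc n).measurable.ennreal_ofReal
  have hIint : ∀ n, ∫⁻ w, I n w ∂torusMeasure ≤
      (⨆ r ∈ Ioo (0 : ℝ) 1, posLogIntegral (radial F r)) * ν univ := by
    intro n
    rw [hI, lintegral_lintegral_swap]
    · have h1 : ∀ θ, ∫⁻ w, ENNReal.ofReal (φ n θ w) ∂torusMeasure =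
          posLogIntegral (radial F (r n)) := by
        intro θ
        exact (measurePreserving_rotate (Circle.exp θ)).lintegral_comp (Real.continuous_posLog.comp
          (continuous_radial hFh (hr n)).norm).measurable.ennreal_ofReal
      simp only [h1, lintegral_const]
      gcongr
      exact le_iSup₂ (f := fun r (_ : r ∈ Ioo (0 : ℝ) 1) => posLogIntegral (radial F r)) (r n) (hr n)
    · exact ((hφc n).comp continuous_swap).measurable.ennreal_ofReal.aemeasurable
  have hfin : ∫⁻ w, liminf (fun n => I n w) atTop ∂torusMeasure ≠ ∞ := by
    refine ne_top_of_le_ne_top (ENNReal.mul_ne_top hFb.ne (measure_ne_top ν univ)) ?_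
    refine (lintegral_liminf_le hIm).trans ?_
    exact (liminf_le_liminf (Eventually.of_forall hIint)).trans_eq (liminf_const _)
  have hB := measurableSet_exists_tendsto_radial hFh
  -- A finite `liminf` of the circle integrals bounds infinitely many of them by one constant
  -- depending on `w`, which is all the disc theorem asks of the slice.
  have key : ∀ᵐ w ∂torusMeasure, ∀ᵐ θ ∂ν, ∃ c,
      Tendsto (fun s => radial F s (rotate (Circle.exp θ) w)) (𝓝[<] 1) (𝓝 c) := by
    filter_upwards [ae_lt_top (Measurable.liminf hIm) hfin] with w hw
    obtain ⟨C, hC1, hC2⟩ := exists_between hw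
    have hfreq := frequently_lt_of_liminf_lt (by isBoundedDefault) hC1
    have hfreq' : ∃ᶠ n in atTop, Real.circleAverage
        (fun z => Real.posLog ‖F (torusCurve w z)‖) 0 (r n) ≤ (2 * Real.pi)⁻¹ * C.toReal := by
      refine hfreq.mono fun n hn => ?_
      have h1 : ∀ θ, F (torusCurve w (circleMap 0 (r n) θ)) =
          radial F (r n) (rotate (Circle.exp θ) w) := fun θ => by
        rw [radial, dilate_rotate (hr n)]
      rw [Real.circleAverage_def, smul_eq_mul]
      simp only [h1]
      refine mul_le_mul_of_nonneg_left ?_ (by positivity)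
      rw [intervalIntegral.integral_of_le (by positivity), integral_eq_lintegral_of_nonneg_ae
        (ae_of_all _ fun θ => Real.posLog_nonneg)]
      · exact ENNReal.toReal_mono hC2.ne hn.le
      · exact ((hφc n).comp (continuous_id.prodMk continuous_const)).aestronglyMeasurable
    filter_upwards [ae_tendsto_circleMap_of_nevanlinna (differentiableOn_comp_torusCurve hFh w)
      hr hrt hfreq'] with θ ⟨c, hc⟩
    refine ⟨c, hc.congr' ?_⟩
    filter_upwards [Ioo_mem_nhdsLT (zero_lt_one (α := ℝ))] with s hs
    rw [radial, dilate_rotate hs]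
  have hmeas : MeasurableSet {p : Torus × ℝ | ∃ c,
      Tendsto (fun s => radial F s (rotate (Circle.exp p.2) p.1)) (𝓝[<] 1) (𝓝 c)} :=
    hB.preimage (hrot.comp continuous_swap).measurable
  rw [Measure.ae_ae_comm hmeas] at key
  have hνne : NeBot (ae ν) := by
    rw [ae_neBot]
    intro h
    rw [h] at hν0
    have := Real.two_pi_pos
    simp at hν0
    linarith
  -- A single good angle suffices, since the rotation by it preserves null sets.
  obtain ⟨θ, hθ⟩ := key.exists
  have h1 := (measurePreserving_rotate (Circle.exp θ)).map_eq
  rw [← h1, ae_map_iff (measurePreserving_rotate (Circle.exp θ)).measurable.aemeasurable hB]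
  exact hθ

/-! ### Convergence theorems for `[0, ∞]`-valued functions -/

section Lintegral

variable {ι X : Type*} [MeasurableSpace X] {μ : Measure X} {l : Filter ι} [l.IsCountablyGenerated]
  {f v : ι → X → ℝ≥0∞} {g : X → ℝ≥0∞}

/-- **Scheffé's lemma**. -/
theorem tendsto_lintegral_tsub_zero (hf : ∀ i, AEMeasurable (f i) μ) (hg : AEMeasurable g μ)
    (hfg : ∀ᵐ x ∂μ, Tendsto (fun i => f i x) l (𝓝 (g x))) (hgt : ∫⁻ x, g x ∂μ ≠ ∞)
    (hint : Tendsto (fun i => ∫⁻ x, f i x ∂μ) l (𝓝 (∫⁻ x, g x ∂μ))) :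
    Tendsto (fun i => ∫⁻ x, (f i x - g x) ∂μ) l (𝓝 0) := by
  have h1 : Tendsto (fun i => ∫⁻ x, (g x - f i x) ∂μ) l (𝓝 (∫⁻ _, 0 ∂μ)) := by
    refine tendsto_lintegral_filter_of_dominated_convergence' g
      (Eventually.of_forall fun i => hg.sub (hf i))
      (Eventually.of_forall fun i => ae_of_all _ fun x => tsub_le_self) hgt ?_
    filter_upwards [hfg, ae_lt_top' hg hgt] with x hx hgx
    have := ENNReal.Tendsto.sub (tendsto_const_nhds (x := g x)) hx (Or.inl hgx.ne)
    rwa [tsub_self] at this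
  rw [lintegral_zero] at h1
  -- Only the part `g - f i`, dominated by `g`, has been treated; the other follows from `(f - g) +
  -- g = max f g = f + (g - f)` in truncated subtraction.
  have h2 : ∀ i, ∫⁻ x, (f i x - g x) ∂μ =
      ∫⁻ x, f i x ∂μ + ∫⁻ x, (g x - f i x) ∂μ - ∫⁻ x, g x ∂μ := by
    intro i
    refine ENNReal.eq_sub_of_add_eq hgt ?_
    rw [← lintegral_add_right' _ hg, ← lintegral_add_left' (hf i)]
    refine lintegral_congr fun x => ?_
    rw [tsub_add_eq_max, add_tsub_eq_max]
  have h3 := ENNReal.Tendsto.sub (hint.add h1) (tendsto_const_nhds (x := ∫⁻ x, g x ∂μ))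
    (Or.inr hgt)
  rw [add_zero, tsub_self] at h3
  exact h3.congr fun i => (h2 i).symm

/-- **Vitali's convergence theorem** for nonnegative functions. -/
theorem tendsto_lintegral_of_tail_le [IsFiniteMeasure μ] (hf : ∀ i, Measurable (f i))
    (hfg : ∀ᵐ x ∂μ, Tendsto (fun i => f i x) l (𝓝 (g x)))
    (hui : ∀ ε : ℝ, 0 < ε → ∃ C : NNReal, ∀ i,
      ∫⁻ x, {x | C ≤ f i x}.indicator (f i) x ∂μ ≤ ENNReal.ofReal ε) :
    Tendsto (fun i => ∫⁻ x, f i x ∂μ) l (𝓝 (∫⁻ x, g x ∂μ)) := by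
  rcases l.eq_or_neBot with rfl | hl
  · exact tendsto_bot
  refine tendsto_of_le_liminf_of_limsup_le ?_ ?_
  · refine le_trans (le_of_eq (lintegral_congr_ae ?_)) (lintegral_liminf_le hf)
    filter_upwards [hfg] with x hx using hx.liminf_eq.symm
  · refine ENNReal.le_of_forall_pos_le_add fun ε hε _ => ?_
    obtain ⟨C, hC⟩ := hui ε hε
    rw [ENNReal.ofReal_coe_nnreal] at hC
    have h1 : Tendsto (fun i => ∫⁻ x, min (f i x) C ∂μ) l (𝓝 (∫⁻ x, min (g x) C ∂μ)) := by
      refine tendsto_lintegral_filter_of_dominated_convergence (fun _ => (C : ℝ≥0∞))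
        (Eventually.of_forall fun i => (hf i).min measurable_const)
        (Eventually.of_forall fun i => ae_of_all _ fun x => min_le_right _ _) ?_ ?_
      · rw [lintegral_const]
        exact ENNReal.mul_ne_top ENNReal.coe_ne_top (measure_ne_top μ univ)
      · filter_upwards [hfg] with x hx using hx.min tendsto_const_nhds
    -- The excess over the truncation at `C` lives where `C ≤ f i` and is at most the tail integral.
    have h2 : ∀ i, ∫⁻ x, f i x ∂μ ≤ ∫⁻ x, min (f i x) C ∂μ + ε := by
      intro i
      refine le_trans ?_ (add_le_add_right (hC i) _)
      rw [← lintegral_add_left ((hf i).min measurable_const)]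
      refine lintegral_mono fun x => ?_
      by_cases hx : (C : ℝ≥0∞) ≤ f i x
      · simp [hx]
      · simp [min_eq_left (not_le.1 hx).le]
    calc limsup (fun i => ∫⁻ x, f i x ∂μ) l
        ≤ limsup (fun i => ∫⁻ x, min (f i x) C ∂μ + ε) l :=
          limsup_le_limsup (Eventually.of_forall h2)
      _ = ∫⁻ x, min (g x) C ∂μ + ε := (h1.add_const _).limsup_eq
      _ ≤ ∫⁻ x, g x ∂μ + ε := by gcongr; exact min_le_left _ _

/-- Dominated convergence with a convergent family of dominating functions. -/
theorem tendsto_lintegral_zero_of_le (hf : ∀ i, AEMeasurable (f i) μ) (hg : AEMeasurable g μ)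
    (hv : ∀ i, AEMeasurable (v i) μ) (hvf : ∀ i x, v i x ≤ f i x)
    (hv0 : ∀ᵐ x ∂μ, Tendsto (fun i => v i x) l (𝓝 0))
    (hfg : ∀ᵐ x ∂μ, Tendsto (fun i => f i x) l (𝓝 (g x))) (hgt : ∫⁻ x, g x ∂μ ≠ ∞)
    (hint : Tendsto (fun i => ∫⁻ x, f i x ∂μ) l (𝓝 (∫⁻ x, g x ∂μ))) :
    Tendsto (fun i => ∫⁻ x, v i x ∂μ) l (𝓝 0) := by
  -- From `v ≤ f` one gets `v ≤ min v g + (f - g)`: the first term is dominated by `g`, the second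
  -- is handled by Scheffé.
  have h1 : Tendsto (fun i => ∫⁻ x, min (v i x) (g x) ∂μ) l (𝓝 (∫⁻ _, 0 ∂μ)) := by
    refine tendsto_lintegral_filter_of_dominated_convergence' g
      (Eventually.of_forall fun i => (hv i).min hg)
      (Eventually.of_forall fun i => ae_of_all _ fun x => min_le_right _ _) hgt ?_
    filter_upwards [hv0] with x hx
    have := hx.min (tendsto_const_nhds (x := g x))
    rwa [min_eq_left zero_le] at this
  have h2 := h1.add (tendsto_lintegral_tsub_zero hf hg hfg hgt hint)
  rw [lintegral_zero, add_zero] at h2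
  refine tendsto_of_tendsto_of_tendsto_of_le_of_le tendsto_const_nhds h2 (fun _ => zero_le)
    fun i => ?_
  rw [← lintegral_add_left' ((hv i).min hg)]
  refine lintegral_mono fun x => ?_
  rcases le_total (v i x) (g x) with h | h
  · simp [min_eq_left h]
  · rw [min_eq_right h, add_tsub_eq_max]
    exact (hvf i x).trans (le_max_right _ _)

end Lintegral

/-! ### The two logarithmic integrands -/

/-- The function `log⁺ |z|`, with values in `[0, ∞]`. -/
noncomputable def posLogENN (z : ℂ) : ℝ≥0∞ := ENNReal.ofReal (Real.posLog ‖z‖)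

/-- The function `log (1 + |z|)`, with values in `[0, ∞]`. -/
noncomputable def logOneAddENN (z : ℂ) : ℝ≥0∞ := ENNReal.ofReal (Real.log (1 + ‖z‖))

theorem continuous_posLogENN : Continuous posLogENN :=
  ENNReal.continuous_ofReal.comp (Real.continuous_posLog.comp continuous_norm)

theorem continuous_logOneAddENN : Continuous logOneAddENN := by
  refine ENNReal.continuous_ofReal.comp (Continuous.log (by fun_prop) fun z => ?_)
  positivity

theorem posLogENN_le_logOneAddENN (z : ℂ) : posLogENN z ≤ logOneAddENN z := by
  refine ENNReal.ofReal_le_ofReal ?_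
  rw [Real.posLog_eq_log_max_one (norm_nonneg z)]
  refine Real.log_le_log (by positivity) (max_le ?_ ?_) <;> linarith [norm_nonneg z]

theorem logOneAddENN_le (z : ℂ) : logOneAddENN z ≤ ENNReal.ofReal (Real.log 2) + posLogENN z := by
  rw [posLogENN, ← ENNReal.ofReal_add (Real.log_nonneg one_le_two) Real.posLog_nonneg]
  refine ENNReal.ofReal_le_ofReal ?_
  have hpos : 0 < max 1 ‖z‖ := by positivity
  rw [Real.posLog_eq_log_max_one (norm_nonneg z), ← Real.log_mul two_ne_zero hpos.ne']
  refine Real.log_le_log (by positivity) ?_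
  linarith [le_max_left 1 ‖z‖, le_max_right 1 ‖z‖]

/-- This rests on `1 + |z - w| ≤ (1 + |z|) (1 + |w|)`. The function `log⁺` has no such
subadditivity: consider `z = 1`, `w = -1`. -/
theorem logOneAddENN_sub_le (z w : ℂ) :
    logOneAddENN (z - w) ≤ logOneAddENN z + logOneAddENN w := by
  have h (z : ℂ) : 0 < 1 + ‖z‖ := by positivity
  rw [logOneAddENN, logOneAddENN, logOneAddENN, ← ENNReal.ofReal_add
    (Real.log_nonneg (by simp)) (Real.log_nonneg (by simp)), ← Real.log_mul (h z).ne' (h w).ne']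
  refine ENNReal.ofReal_le_ofReal (Real.log_le_log (h _) ?_)
  nlinarith [norm_sub_le z w, mul_nonneg (norm_nonneg z) (norm_nonneg w)]

theorem logOneAddENN_neg (z : ℂ) : logOneAddENN (-z) = logOneAddENN z := by
  simp [logOneAddENN]

theorem logOneAddENN_zero : logOneAddENN 0 = 0 := by simp [logOneAddENN]

theorem eLpNorm_one_posLog {X : Type*} [MeasurableSpace X] {μ : Measure X} (h : X → ℂ) :
    eLpNorm (fun x => Real.posLog ‖h x‖) 1 μ = ∫⁻ x, posLogENN (h x) ∂μ := by
  rw [eLpNorm_one_eq_lintegral_enorm]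
  exact lintegral_congr fun x => Real.enorm_of_nonneg Real.posLog_nonneg

theorem eLpNorm_one_indicator_posLog {X : Type*} [MeasurableSpace X] {μ : Measure X} (h : X → ℂ)
    {s : Set X} (hs : MeasurableSet s) :
    eLpNorm (s.indicator fun x => Real.posLog ‖h x‖) 1 μ = ∫⁻ x in s, posLogENN (h x) ∂μ := by
  rw [eLpNorm_indicator_eq_eLpNorm_restrict hs, eLpNorm_one_posLog]

/-! ### Uniform integrability and convergence of logarithmic integrals -/

section Equivalence

variable {ι X : Type*} [MeasurableSpace X] {μ : Measure X} {l : Filter ι}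
  [l.IsCountablyGenerated] {f : ι → X → ℂ} {g : X → ℂ}

/-- For indices in a suitable set of `l`, Scheffé makes the excess of `Φ (f i)` over `Φ (g)` small
in mean, and `Φ (g)` has small integral over small sets. The remaining indices are covered by the
uniform bound `hloc`. -/
theorem unifIntegrable_posLog_of_tendsto {Φ : ℂ → ℝ≥0∞} (hΦ : Continuous Φ)
    (hΦl : ∀ z, posLogENN z ≤ Φ z) (hf : ∀ i, Measurable (f i)) (hg : AEMeasurable g μ)
    (hfg : ∀ᵐ x ∂μ, Tendsto (fun i => f i x) l (𝓝 (g x)))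
    (hloc : ∀ S ∈ l, ∃ M : ℝ, ∀ i ∉ S, ∀ x, ‖f i x‖ ≤ M) (hgt : ∫⁻ x, Φ (g x) ∂μ ≠ ∞)
    (hint : Tendsto (fun i => ∫⁻ x, Φ (f i x) ∂μ) l (𝓝 (∫⁻ x, Φ (g x) ∂μ))) :
    UnifIntegrable (fun i x => Real.posLog ‖f i x‖) 1 μ := by
  intro ε hε
  have hε2 : ENNReal.ofReal (ε / 2) ≠ 0 := by
    rw [ne_eq, ENNReal.ofReal_eq_zero, not_le]; positivity
  have hsplit : ENNReal.ofReal (ε / 2) + ENNReal.ofReal (ε / 2) = ENNReal.ofReal ε := by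
    rw [← ENNReal.ofReal_add (by positivity) (by positivity), add_halves]
  have h1 : Tendsto (fun i => ∫⁻ x, (Φ (f i x) - Φ (g x)) ∂μ) l (𝓝 0) :=
    tendsto_lintegral_tsub_zero (fun i => (hΦ.measurable.comp (hf i)).aemeasurable)
      (hΦ.measurable.comp_aemeasurable hg)
      (hfg.mono fun x hx => (hΦ.tendsto _).comp hx) hgt hint
  obtain ⟨M, hM⟩ := hloc _ (h1.eventually_lt_const (pos_iff_ne_zero.2 hε2))
  obtain ⟨δ, hδ, hδs⟩ := exists_pos_setLIntegral_lt_of_measure_lt hgt hε2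
  have hM1 : 0 < Real.posLog M + 1 := by linarith [Real.posLog_nonneg (x := M)]
  -- The first entry serves the uniformly bounded indices, the `+ 1` avoiding division by 0. The
  -- second must lie strictly below `δ`, which may be `∞`; hence the cap at 1 and the halving.
  set δ' : ℝ := min (ε / (Real.posLog M + 1)) ((min δ 1).toReal / 2) with hδ'
  have hm : 0 < (min δ 1).toReal :=
    ENNReal.toReal_pos (lt_min hδ one_pos).ne' (ne_top_of_le_ne_top ENNReal.one_ne_top
      (min_le_right _ _))
  refine ⟨δ', lt_min (by positivity) (by positivity), fun i s hs hμs => ?_⟩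
  rw [eLpNorm_one_indicator_posLog _ hs]
  by_cases hi : ∫⁻ x, (Φ (f i x) - Φ (g x)) ∂μ < ENNReal.ofReal (ε / 2)
  · have hμδ : μ s < δ := by
      refine hμs.trans_lt (lt_of_lt_of_le ?_ (min_le_left δ 1))
      rw [ENNReal.ofReal_lt_iff_lt_toReal (le_min (by positivity) (by positivity))
        (ne_top_of_le_ne_top ENNReal.one_ne_top (min_le_right _ _))]
      exact (min_le_right _ _).trans_lt (half_lt_self hm)
    calc ∫⁻ x in s, posLogENN (f i x) ∂μ
        ≤ ∫⁻ x in s, (Φ (g x) + (Φ (f i x) - Φ (g x))) ∂μ := by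
          refine lintegral_mono fun x => (hΦl _).trans ?_
          rw [add_tsub_eq_max]
          exact le_max_right _ _
      _ = ∫⁻ x in s, Φ (g x) ∂μ + ∫⁻ x in s, (Φ (f i x) - Φ (g x)) ∂μ :=
          lintegral_add_left' (hΦ.measurable.comp_aemeasurable hg).restrict _
      _ ≤ ENNReal.ofReal (ε / 2) + ENNReal.ofReal (ε / 2) :=
          add_le_add (hδs s hμδ).le ((setLIntegral_le_lintegral _ _).trans hi.le)
      _ = ENNReal.ofReal ε := hsplit
  · calc ∫⁻ x in s, posLogENN (f i x) ∂μ
        ≤ ∫⁻ _ in s, ENNReal.ofReal (Real.posLog M) ∂μ := lintegral_mono fun x =>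
          ENNReal.ofReal_le_ofReal (Real.posLog_le_posLog (norm_nonneg _) (hM i hi x))
      _ = ENNReal.ofReal (Real.posLog M) * μ s := setLIntegral_const _ _
      _ ≤ ENNReal.ofReal (Real.posLog M) * ENNReal.ofReal (ε / (Real.posLog M + 1)) := by
          gcongr
          exact hμs.trans (ENNReal.ofReal_le_ofReal (min_le_left _ _))
      _ ≤ ENNReal.ofReal ε := by
          rw [← ENNReal.ofReal_mul Real.posLog_nonneg]
          refine ENNReal.ofReal_le_ofReal ?_
          rw [mul_div_assoc', div_le_iff₀ hM1]
          nlinarith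

/-- Uniform integrability of `log⁺ |fᵢ|` in terms of the convergence of logarithmic integrals. -/
theorem tfae_uniformIntegrable_posLog [IsProbabilityMeasure μ] [l.NeBot]
    (hf : ∀ i, Measurable (f i))
    (hfg : ∀ᵐ x ∂μ, Tendsto (fun i => f i x) l (𝓝 (g x)))
    (hloc : ∀ S ∈ l, ∃ M : ℝ, ∀ i ∉ S, ∀ x, ‖f i x‖ ≤ M) {C : ℝ≥0∞} (hC : C ≠ ∞)
    (hb : ∀ i, ∫⁻ x, posLogENN (f i x) ∂μ ≤ C) :
    [ UniformIntegrable (fun i x => Real.posLog ‖f i x‖) 1 μ,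
      Tendsto (fun i => ∫⁻ x, logOneAddENN (f i x) ∂μ) l (𝓝 (∫⁻ x, logOneAddENN (g x) ∂μ)),
      Tendsto (fun i => ∫⁻ x, logOneAddENN (f i x - g x) ∂μ) l (𝓝 0),
      Tendsto (fun i => ∫⁻ x, posLogENN (f i x) ∂μ) l (𝓝 (∫⁻ x, posLogENN (g x) ∂μ)) ].TFAE := by
  have hg : AEMeasurable g μ :=
    aemeasurable_of_tendsto_metrizable_ae l (fun i => (hf i).aemeasurable) hfg
  have hPm := continuous_posLogENN.measurable
  have hLm := continuous_logOneAddENN.measurable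
  have hPfg : ∀ᵐ x ∂μ, Tendsto (fun i => posLogENN (f i x)) l (𝓝 (posLogENN (g x))) :=
    hfg.mono fun x hx => (continuous_posLogENN.tendsto _).comp hx
  -- Fatou's lemma makes the limit log-integrable, which domination, Scheffé and subtraction in `[0,
  -- ∞]` all need.
  have hPg : ∫⁻ x, posLogENN (g x) ∂μ ≠ ∞ := by
    refine ne_top_of_le_ne_top hC ?_
    calc ∫⁻ x, posLogENN (g x) ∂μ = ∫⁻ x, liminf (fun i => posLogENN (f i x)) l ∂μ :=
          lintegral_congr_ae (hPfg.mono fun x hx => hx.liminf_eq.symm)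
      _ ≤ liminf (fun i => ∫⁻ x, posLogENN (f i x) ∂μ) l :=
          lintegral_liminf_le fun i => hPm.comp (hf i)
      _ ≤ C := (liminf_le_liminf (Eventually.of_forall hb)).trans_eq (liminf_const _)
  have hLg : ∫⁻ x, logOneAddENN (g x) ∂μ ≠ ∞ := by
    refine ne_top_of_le_ne_top ?_ (lintegral_mono fun x => logOneAddENN_le (g x))
    rw [lintegral_add_left measurable_const, lintegral_const, measure_univ, mul_one]
    exact ENNReal.add_ne_top.2 ⟨ENNReal.ofReal_ne_top, hPg⟩
  tfae_have 1 → 4 := by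
    intro hui
    refine tendsto_lintegral_of_tail_le (fun i => hPm.comp (hf i)) hPfg fun ε hε => ?_
    obtain ⟨K, hK⟩ := hui.spec one_ne_zero ENNReal.one_ne_top hε
    refine ⟨K, fun i => ?_⟩
    refine le_trans (le_of_eq ?_) (hK i)
    rw [eLpNorm_one_eq_lintegral_enorm]
    refine lintegral_congr fun x => ?_
    have h1 : ‖Real.posLog ‖f i x‖‖ₑ = posLogENN (f i x) :=
      Real.enorm_of_nonneg Real.posLog_nonneg
    rw [enorm_indicator_eq_indicator_enorm]
    simp only [indicator, mem_ofPred_eq, h1]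
    congr 1
    rw [← h1, ← ofReal_norm, ← ENNReal.ofReal_coe_nnreal]
    rw [ENNReal.ofReal_le_ofReal_iff (norm_nonneg _)]
    rfl
  tfae_have 4 → 3 := by
    intro h4
    set c : ℝ≥0∞ := ENNReal.ofReal (Real.log 2) + ENNReal.ofReal (Real.log 2) with hc
    have hct : c ≠ ∞ := ENNReal.add_ne_top.2 ⟨ENNReal.ofReal_ne_top, ENNReal.ofReal_ne_top⟩
    have hgP : AEMeasurable (fun x => posLogENN (g x)) μ := hPm.comp_aemeasurable hg
    have hsum : ∀ h : X → ℂ,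
        ∫⁻ x, (c + posLogENN (h x) + posLogENN (g x)) ∂μ =
          c + ∫⁻ x, posLogENN (h x) ∂μ + ∫⁻ x, posLogENN (g x) ∂μ := by
      intro h
      rw [lintegral_add_right' _ hgP, lintegral_add_left measurable_const, lintegral_const,
        measure_univ, mul_one]
    -- The majorant of `log (1 + |f i - g|)` is `2 log 2 + log⁺ |f i| + log⁺ |g|`, whose integrals
    -- converge by (4).
    refine tendsto_lintegral_zero_of_le
      (f := fun i x => c + posLogENN (f i x) + posLogENN (g x))
      (g := fun x => c + posLogENN (g x) + posLogENN (g x))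
      (fun i => ((hPm.comp (hf i)).const_add c).aemeasurable.add hgP)
      ((hgP.const_add c).add hgP)
      (fun i => hLm.comp_aemeasurable ((hf i).aemeasurable.sub hg)) (fun i x => ?_) ?_ ?_ ?_ ?_
    · refine (logOneAddENN_sub_le _ _).trans ((add_le_add (logOneAddENN_le _)
        (logOneAddENN_le _)).trans_eq ?_)
      rw [hc]; ring
    · filter_upwards [hfg] with x hx
      have h5 := (continuous_logOneAddENN.tendsto _).comp (hx.sub_const (g x))
      rwa [sub_self, logOneAddENN_zero] at h5
    · filter_upwards [hPfg] with x hx using (hx.const_add c).add_const _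
    · rw [hsum g]
      exact ENNReal.add_ne_top.2 ⟨ENNReal.add_ne_top.2 ⟨hct, hPg⟩, hPg⟩
    · rw [hsum g]
      simp only [fun i => hsum (f i)]
      exact (h4.const_add c).add_const _
  tfae_have 3 → 2 := by
    intro h3
    have hm : ∀ i, AEMeasurable (fun x => logOneAddENN (f i x - g x)) μ := fun i =>
      hLm.comp_aemeasurable ((hf i).aemeasurable.sub hg)
    have hup := (tendsto_const_nhds (x := ∫⁻ x, logOneAddENN (g x) ∂μ)).add h3
    have hlow := ENNReal.Tendsto.sub (tendsto_const_nhds (x := ∫⁻ x, logOneAddENN (g x) ∂μ)) h3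
      (Or.inl hLg)
    rw [add_zero] at hup
    rw [tsub_zero] at hlow
    refine tendsto_of_tendsto_of_tendsto_of_le_of_le hlow hup (fun i => ?_) (fun i => ?_)
    · simp only
      rw [tsub_le_iff_right, ← lintegral_add_right' _ (hm i)]
      refine lintegral_mono fun x => ?_
      have := logOneAddENN_sub_le (f i x) (f i x - g x)
      rwa [sub_sub_cancel] at this
    · simp only
      rw [← lintegral_add_right' _ (hm i)]
      refine lintegral_mono fun x => ?_
      have := logOneAddENN_sub_le (f i x - g x) (-g x)
      rw [sub_neg_eq_add, sub_add_cancel, logOneAddENN_neg] at this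
      rwa [add_comm]
  tfae_have 2 → 1 := by
    intro h2
    refine ⟨fun i => ?_, unifIntegrable_posLog_of_tendsto continuous_logOneAddENN
      posLogENN_le_logOneAddENN hf hg hfg hloc hLg h2, C.toNNReal, fun i => ?_⟩
    · exact (Real.continuous_posLog.measurable.comp (hf i).norm).aestronglyMeasurable
    · rw [ENNReal.coe_toNNReal hC, eLpNorm_one_posLog]
      exact hb i
  tfae_finish

end Equivalence

end InfSmirnov

/-! ### The theorem on the infinite polydisc -/

theorem proposition2p10 (F : InfSmirnov.EllOne → ℂ) (hF : F ∈ InfSmirnov.nevanlinnaClass) :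
    (∀ᵐ w ∂InfSmirnov.torusMeasure,
      Tendsto (fun r : ℝ => InfSmirnov.radial F r w) (𝓝[<] 1) (𝓝 (InfSmirnov.boundary F w))) ∧
    [ F ∈ InfSmirnov.smirnovClass,
      Tendsto (fun r : ℝ => InfSmirnov.normZero (InfSmirnov.radial F r)) (𝓝[<] 1)
        (𝓝 (InfSmirnov.normZero (InfSmirnov.boundary F))),
      Tendsto (fun r : ℝ => InfSmirnov.normZero
        (fun w => InfSmirnov.radial F r w - InfSmirnov.boundary F w)) (𝓝[<] 1) (𝓝 0),
      Tendsto (fun r : ℝ => InfSmirnov.posLogIntegral (InfSmirnov.radial F r)) (𝓝[<] 1)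
        (𝓝 (InfSmirnov.posLogIntegral (InfSmirnov.boundary F))) ].TFAE := by
  have hlim : ∀ᵐ w ∂InfSmirnov.torusMeasure,
      Tendsto (fun r : ℝ => InfSmirnov.radial F r w) (𝓝[<] 1) (𝓝 (InfSmirnov.boundary F w)) := by
    filter_upwards [InfSmirnov.ae_exists_tendsto_radial hF] with w hw
    exact tendsto_nhds_limUnder hw
  refine ⟨hlim, ?_⟩
  -- Uniform integrability is indexed by the subtype `Ioo 0 1`, so the limit `r → 1⁻` is pulled back
  -- to it.
  set l : Filter (Ioo (0 : ℝ) 1) := comap Subtype.val (𝓝[<] (1 : ℝ)) with hl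
  have hmap : map Subtype.val l = 𝓝[<] (1 : ℝ) := by
    rw [hl, map_comap_setCoe_val, inf_eq_left, le_principal_iff]
    exact Ioo_mem_nhdsLT zero_lt_one
  have hne : l.NeBot := by
    rw [← map_neBot_iff Subtype.val, hmap]
    infer_instance
  have htend {Y : Type} [TopologicalSpace Y] (u : ℝ → Y) (y : Y) :
      Tendsto (fun r : Ioo (0 : ℝ) 1 => u r) l (𝓝 y) ↔ Tendsto u (𝓝[<] 1) (𝓝 y) := by
    rw [← hmap, tendsto_map'_iff]
    rfl
  -- Radii outside a set of `l` satisfy `r ≤ max a 0` for some `a < 1`, so the compactness bound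
  -- applies.
  have hloc : ∀ S ∈ l, ∃ M : ℝ, ∀ i ∉ S, ∀ w, ‖InfSmirnov.radial F (i : ℝ) w‖ ≤ M := by
    intro S hS
    obtain ⟨T, hT, hTS⟩ := mem_comap.1 hS
    obtain ⟨a, ha, haT⟩ := (mem_nhdsLT_iff_exists_Ioo_subset' (zero_lt_one (α := ℝ))).1 hT
    obtain ⟨M, hM⟩ := InfSmirnov.exists_norm_radial_le hF.1 (le_max_right a 0)
      (max_lt ha zero_lt_one)
    refine ⟨M, fun i hi => hM i i.2 ?_⟩
    by_contra hia
    exact hi (hTS (haT ⟨(le_max_left _ _).trans_lt (not_le.1 hia), i.2.2⟩))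
  have key := InfSmirnov.tfae_uniformIntegrable_posLog (l := l) (μ := InfSmirnov.torusMeasure)
    (f := fun i : Ioo (0 : ℝ) 1 => InfSmirnov.radial F i) (g := InfSmirnov.boundary F)
    (fun i => (InfSmirnov.continuous_radial hF.1 i.2).measurable)
    (hlim.mono fun w hw => (htend _ _).2 hw) hloc hF.2.ne
    (fun i => le_iSup₂ (f := fun r (_ : r ∈ Ioo (0 : ℝ) 1) =>
      InfSmirnov.posLogIntegral (InfSmirnov.radial F r)) i i.2)
  have hsm : F ∈ InfSmirnov.smirnovClass ↔ UniformIntegrable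
      (fun (r : Ioo (0 : ℝ) 1) (w : InfSmirnov.Torus) => Real.posLog ‖InfSmirnov.radial F r w‖) 1
      InfSmirnov.torusMeasure := ⟨fun h => h.2, fun h => ⟨hF, h⟩⟩
  rw [hsm, ← htend, ← htend, ← htend]
  exact key
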